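/- Consider a reconfigurable surface with $M$ elements divided into $N\ge 1$ subarrays of $M/N\in\mathbb{Z}$ elements. Let $\rho,\alpha,\beta,P_{\mathrm{data}},P_{\mathrm{pilot}}\ge 0$ and $\sigma^2>0$. The direct path is $p\sim\mathcal{CN}(0,\rho)$, the channel from the user to element $i$ of subarray $n$ is $b_{n,i}\sim\mathcal{CN}(0,\beta)$, and the channel from that element to the base station is $\sqrt{\alpha}e^{-j\phi_{n,i}}$ with deterministic phase $\phi_{n,i}$. Put $Z_n=\sum_{i=1}^{M/N}\sqrt{\alpha}e^{-j\phi_{n,i}}b_{n,i}$ and $\mathbf h=(p,Z_1,\dots,Z_N)^{\mathrm T}$. In $N+1$ pilot slots the base station receives $\mathbf y=\sqrt{P_{\mathrm{pilot}}}\,\boldsymbol\Psi\mathbf h+\mathbf w$, where $\mathbf w\sim\mathcal{CN}(\mathbf 0,\sigma^2\mathbf I_{N+1})$ and row $t$ of $\boldsymbol\Psi$ is $(1,e^{-j\psi_{t,1}},\dots,e^{-j\psi_{t,N}})$, with $\boldsymbol\Psi^{\mathrm H}\boldsymbol\Psi=(N+1)\mathbf I_{N+1}$. All $p$, $b_{n,i}$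 and entries of $\mathbf w$ are mutually independent. Let $\hat p=\mathbb E\{p\mid\mathbf y\}$ and $\hat Z_n=\mathbb E\{Z_n\mid\mathbf y\}$ be the minimum mean square error estimates (with the convention $\arg 0=0$). Let $K=2^b$ and let $Q_b$ map a complex number to the phase of a nearest one of $K$ equally spaced points $e^{j(\theta_0+2\pi k/K)}$, $k=0,\dots,K-1$, on the unit circle ($\theta_0\in\mathbb R$ and the breaking of ties are arbitrary). For phase-shifts $c_1,\dots,c_N$ let $$\mathrm{SNR}(c_1,\dots,c_N)=\frac{P_{\mathrm{data}}}{\sigma^2}\Big|p+\sum_{n=1}^N Z_n e^{-jc_n}\Big|^2 .$$ With $\hat c_n=Q_b\big(e^{j\arg(\hat Z_n)}e^{-j\arg(\hat p)}\big)$ and $\mathrm{sinc}(x)=\sin(\pi x)/(\pi x)$, the average SNR is finite and $$\mathbb E\{\mathrm{SNR}(\hat c_1,\dots,\hat c_N)\}=\frac{P_{\mathrm{data}}}{\sigma^2}\Bigg(\rho+\alpha\beta M+\frac{\pi}{2}\frac{\rho\,\alpha\beta M\,\frac{P_{\mathrm{pilot}}}{\sigma^2}\,\mathrm{sinc}(1/K)}{\sqrt{\big(\rho\frac{P_{\mathrm{pilot}}}{\sigma^2}+\frac1{N+1}\big)\big(\frac{\alpha\beta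 M}{N}\frac{P_{\mathrm{pilot}}}{\sigma^2}+\frac1{N+1}\big)}}+\frac{\pi}{4}\Big(1-\frac1N\Big)\frac{(\alpha\beta M)^2\frac{P_{\mathrm{pilot}}}{\sigma^2}\,\mathrm{sinc}^2(1/K)}{\frac{\alpha\beta M}{N}\frac{P_{\mathrm{pilot}}}{\sigma^2}+\frac1{N+1}}\Bigg).$$ Moreover, as $K\to\infty$ and $P_{\mathrm{pilot}}\to\infty$ jointly, the right-hand side converges to $$\frac{P_{\mathrm{data}}}{\sigma^2}\Big(\frac{\pi}{4}\big(\sqrt\rho+\sqrt{\alpha\beta MN}\big)^2+\Big(1-\frac{\pi}{4}\Big)(\rho+\alpha\beta M)\Big),$$ which is the average SNR with perfect channel knowledge and unquantized phase-shifts, that is, the (finite) mean of $\mathrm{SNR}(c_1,\dots,c_N)$ for $c_n=\arg(Z_n)-\arg(p)$. -/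

import Mathlib

open MeasureTheory ProbabilityTheory Filter Topology

noncomputable section

namespace RIS

/-- The circularly symmetric complex Gaussian distribution `CN(0, v)`: the real and imaginary parts
are independent, each with distribution `N(0, v / 2)`. -/
def complexGaussian (v : ℝ) : Measure ℂ :=
  ((gaussianReal 0 (v / 2).toNNReal).prod (gaussianReal 0 (v / 2).toNNReal)).map
    Complex.measurableEquivRealProd.symm

/-- The random quantities of the system with `N` subarrays of `L` elements each: the direct path `p`
has law `CN(0, ρ)`, the channel `b n i` from the user to element `i` of subarray `n` has law
`CN(0, β)`, the receiver noise `w t` in the `t`-th pilot slot has law `CN(0, σ²)`, and all of them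
are mutually independent. -/
structure IsRayleighModel {Ω : Type*} [MeasurableSpace Ω] (μ : Measure Ω) {N L : ℕ}
    (ρ β σ : ℝ) (p : Ω → ℂ) (b : Fin N → Fin L → Ω → ℂ) (w : Fin (N + 1) → Ω → ℂ) : Prop where
  measurable_direct : Measurable p
  measurable_element : ∀ n i, Measurable (b n i)
  measurable_noise : ∀ t, Measurable (w t)
  law_direct : μ.map p = complexGaussian ρ
  law_element : ∀ n i, μ.map (b n i) = complexGaussian β
  law_noise : ∀ t, μ.map (w t) = complexGaussian (σ ^ 2)
  indep : iIndepFun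
    (Sum.elim (fun _ : Unit => p)
      (Sum.elim (fun q : Fin N × Fin L => b q.1 q.2) w)) μ

/-- The concatenated channel `Z n = ∑ i, √α e^{-j φ n i} b n i` of subarray `n`. -/
def subarrayChannel {Ω : Type*} {N L : ℕ} (α : ℝ) (φ : Fin N → Fin L → ℝ)
    (b : Fin N → Fin L → Ω → ℂ) (n : Fin N) (ω : Ω) : ℂ :=
  ∑ i, (Real.sqrt α : ℂ) * Complex.exp (-(Complex.I * (φ n i : ℂ))) * b n i ω

/-- The channel vector `h = (p, Z 1, …, Z N)`. -/
def channelVector {Ω : Type*} {N : ℕ} (p : Ω → ℂ) (Z : Fin N → Ω → ℂ) (ω : Ω) :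
    Fin (N + 1) → ℂ :=
  Fin.cons (p ω) fun n => Z n ω

/-- The pilot matrix: row `t` is `(1, e^{-j ψ t 1}, …, e^{-j ψ t N})`. -/
def pilotMatrix {N : ℕ} (ψ : Fin (N + 1) → Fin N → ℝ) :
    Matrix (Fin (N + 1)) (Fin (N + 1)) ℂ :=
  Matrix.of fun t => Fin.cons 1 fun n => Complex.exp (-(Complex.I * (ψ t n : ℂ)))

/-- The received pilot signal `√P_pilot Ψ h + w`. -/
def pilotSignal {Ω : Type*} {N : ℕ} (Ppilot : ℝ) (ψ : Fin (N + 1) → Fin N → ℝ)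
    (h : Ω → Fin (N + 1) → ℂ) (w : Fin (N + 1) → Ω → ℂ) (ω : Ω) : Fin (N + 1) → ℂ :=
  (Real.sqrt Ppilot : ℂ) • (pilotMatrix ψ).mulVec (h ω) + fun t => w t ω

/-- The minimum mean square error estimate of `X` from the observation `Y`: the conditional mean
`E[X | Y]`. -/
def mmseEstimate {Ω : Type*} [MeasurableSpace Ω] (μ : Measure Ω) {N : ℕ} (X : Ω → ℂ)
    (Y : Ω → Fin (N + 1) → ℂ) : Ω → ℂ :=
  condExp (MeasurableSpace.comap Y inferInstance) μ X

/-- The `2 ^ b` equally spaced phases `θ₀ + 2 π k / 2 ^ b`. -/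
def phaseLevel (b : ℕ) (θ₀ : ℝ) (k : Fin (2 ^ b)) : ℝ :=
  θ₀ + 2 * Real.pi * (k : ℕ) / 2 ^ b

/-- `Q` maps each complex number to the phase of a nearest one of the `2 ^ b` equally spaced points
on the unit circle (ties are broken in an arbitrary way). -/
structure IsPhaseQuantizer (b : ℕ) (θ₀ : ℝ) (Q : ℂ → ℝ) : Prop where
  mem_levels : ∀ z, Q z ∈ Set.range (phaseLevel b θ₀)
  nearest : ∀ z k, ‖z - Complex.exp (Complex.I * (Q z : ℂ))‖ ≤
    ‖z - Complex.exp (Complex.I * (phaseLevel b θ₀ k : ℂ))‖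

theorem exists_isPhaseQuantizer (b : ℕ) (θ₀ : ℝ) : ∃ Q, IsPhaseQuantizer b θ₀ Q := by
  have h : ∀ z : ℂ, ∃ k, ∀ k', ‖z - Complex.exp (Complex.I * (phaseLevel b θ₀ k : ℂ))‖ ≤
      ‖z - Complex.exp (Complex.I * (phaseLevel b θ₀ k' : ℂ))‖ := fun z =>
    Finite.exists_min fun k => ‖z - Complex.exp (Complex.I * (phaseLevel b θ₀ k : ℂ))‖
  choose f hf using h
  exact ⟨fun z => phaseLevel b θ₀ (f z), fun z => ⟨f z, rfl⟩, hf⟩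

/-- The quantized phase-shift `Q (e^{j arg Ẑ} e^{-j arg p̂})`. -/
def quantizedPhase (Q : ℂ → ℝ) (Zhat phat : ℂ) : ℝ :=
  Q (Complex.exp (Complex.I * (Complex.arg Zhat : ℂ)) *
    Complex.exp (-(Complex.I * (Complex.arg phat : ℂ))))

/-- The instantaneous data SNR `(P_data / σ²) |p + ∑ n, Z n e^{-j c n}|²` with phase-shifts `c`. -/
def dataSNR {N : ℕ} (Pdata σ : ℝ) (p : ℂ) (Z : Fin N → ℂ) (c : Fin N → ℝ) : ℝ :=
  Pdata / σ ^ 2 * ‖p + ∑ n, Z n * Complex.exp (-(Complex.I * (c n : ℂ)))‖ ^ 2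

/-- The normalized sinc function `sin (π x) / (π x)`, with value `1` at `0`. -/
def nsinc (x : ℝ) : ℝ := Real.sinc (Real.pi * x)

/-- The closed form of the average SNR with imperfect CSI and `K` phase levels. -/
def averageSNR (M N K : ℕ) (ρ α β σ Pdata Ppilot : ℝ) : ℝ :=
  Pdata / σ ^ 2 *
    (ρ + α * β * M
      + Real.pi / 2 * (ρ * (α * β * M) * (Ppilot / σ ^ 2) * nsinc (1 / K)
          / Real.sqrt ((ρ * (Ppilot / σ ^ 2) + 1 / (N + 1))
            * (α * β * M / N * (Ppilot / σ ^ 2) + 1 / (N + 1))))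
      + Real.pi / 4 * (1 - 1 / N)
        * ((α * β * M) ^ 2 * (Ppilot / σ ^ 2) * nsinc (1 / K) ^ 2
          / (α * β * M / N * (Ppilot / σ ^ 2) + 1 / (N + 1))))

/-- The closed form of the average SNR with perfect CSI and unquantized phases. -/
def perfectAverageSNR (M N : ℕ) (ρ α β σ Pdata : ℝ) : ℝ :=
  Pdata / σ ^ 2 *
    (Real.pi / 4 * (Real.sqrt ρ + Real.sqrt (α * β * M * N)) ^ 2
      + (1 - Real.pi / 4) * (ρ + α * β * M))

end RIS

end

namespace RIS

/-! Correlating `y` with the orthogonal pilots turns it into scalar observations u_k = √P h_k +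
w'_k, where w' is white with variance τ = σ²/(N+1). The passage between y and u is invertible, so
conditioning on either is the same. The estimate of h_k is s_k u_k with s_k the `mmseGain`, and
uncorrelatedness of jointly Gaussian variables makes the error e_k = h_k − s_k u_k independent of
all observations (`map_channel_pilotNoise`, `map_error_observation`,
`condExp_error_add_observation`).

The phase of p̂ enters every phase-shift and so couples the subarrays. Multiplying the combined
channel by e^{-j arg p̂} keeps its modulus, and rotating all (e_n, u_n) with n ≥ 1 by this phase
keeps the joint law (`measurePreserving_rotate_complexGaussian`). Afterwards each summand depends
only on its own pair (e_k, u_k), so the summands are independent and the mean square is ∑ V_k + (∑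
m_k)² − ∑ m_k², with m_k their real means (`integral_norm_sum_sq`).

In polar coordinates the argument of u_k is uniform and independent of |u_k|. Hence m_0 = s_0 √(π
d_0)/2 with d_k = P V_k + τ, and for n ≥ 1 the same expression is damped by the circular mean of the
quantization error, which is sinc(1/K) (`IsPhaseQuantizer.integral_exp`). With perfect knowledge the
summands become |h_k|, with means √(π V_k)/2. -/

/-! ### The complex Gaussian law: moments, characteristic function, linear images. -/

open Complex in
theorem integral_complexGaussian {E : Type*} [NormedAddCommGroup E] [NormedSpace ℝ E] (v : ℝ)
    (F : ℂ → E) :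
    ∫ z, F z ∂complexGaussian v = ∫ x : ℝ × ℝ, F (x.1 + x.2 * I)
      ∂((gaussianReal 0 (v / 2).toNNReal).prod (gaussianReal 0 (v / 2).toNNReal)) := by
  rw [complexGaussian, integral_map_equiv]
  simp [Complex.mk_eq_add_mul_I]

instance isProbabilityMeasure_complexGaussian (v : ℝ) :
    IsProbabilityMeasure (complexGaussian v) :=
  Measure.isProbabilityMeasure_map (MeasurableEquiv.measurable _).aemeasurable

open Complex in
theorem charFun_complexGaussian {v : ℝ} (hv : 0 ≤ v) (t : ℂ) :
    charFun (complexGaussian v) t = cexp (-(v * ‖t‖ ^ 2 / 4 : ℝ)) := by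
  have h : ∀ s : ℝ, ∫ x : ℝ, cexp (s * x * I) ∂gaussianReal 0 (v / 2).toNNReal
      = cexp (-(v * s ^ 2 / 4 : ℝ)) := by
    intro s
    rw [← charFun_apply_real, charFun_gaussianReal]
    congr 1
    simp only [Real.coe_toNNReal _ (show 0 ≤ v / 2 by positivity)]
    push_cast
    ring
  rw [charFun_apply, integral_complexGaussian]
  have h2 : ∀ x : ℝ × ℝ, cexp ((inner ℝ (x.1 + x.2 * I : ℂ) t : ℝ) * I)
      = cexp (t.re * x.1 * I) * cexp (t.im * x.2 * I) := by
    intro x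
    rw [← Complex.exp_add]
    congr 1
    simp [Complex.inner]
    ring
  simp_rw [h2]
  rw [integral_prod_mul (fun x : ℝ => cexp (t.re * x * I)) (fun x : ℝ => cexp (t.im * x * I)),
    h, h, ← Complex.exp_add]
  congr 1
  rw [← Complex.normSq_eq_norm_sq, Complex.normSq_apply]
  push_cast
  ring

theorem memLp_id_complexGaussian (v : ℝ) : MemLp (fun z : ℂ => z) 2 (complexGaussian v) := by
  have h : MemLp (fun x : ℝ => x) 2 (gaussianReal 0 (v / 2).toNNReal) :=
    memLp_id_gaussianReal' 2 (by simp)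
  rw [complexGaussian, (MeasurableEquiv.measurableEmbedding _).memLp_map_measure_iff]
  rw [memLp_two_iff_integrable_sq_norm]
  · have h1 := (h.integrable_sq.comp_fst (gaussianReal 0 (v / 2).toNNReal)).add
      (h.integrable_sq.comp_snd (gaussianReal 0 (v / 2).toNNReal))
    refine h1.congr (ae_of_all _ fun x => ?_)
    simp [← Complex.normSq_eq_norm_sq, Complex.normSq_apply]
    ring
  · exact (MeasurableEquiv.measurable _).aestronglyMeasurable

theorem integral_id_complexGaussian (v : ℝ) : ∫ z, z ∂complexGaussian v = 0 := by
  have h : Integrable (fun x : ℝ => (x : ℂ)) (gaussianReal 0 (v / 2).toNNReal) :=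
    ((memLp_id_gaussianReal' 1 (by simp)).integrable le_rfl).ofReal
  rw [integral_complexGaussian, integral_add (h.comp_fst _) ((h.mul_const _).comp_snd _),
    integral_fun_fst (fun x : ℝ => (x : ℂ)), integral_fun_snd (fun x : ℝ => (x : ℂ) * Complex.I),
    integral_mul_const, integral_complex_ofReal]
  simp [integral_id_gaussianReal]

theorem integral_norm_sq_complexGaussian {v : ℝ} (hv : 0 ≤ v) :
    ∫ z, ‖z‖ ^ 2 ∂complexGaussian v = v := by
  have h : MemLp (fun x : ℝ => x) 2 (gaussianReal 0 (v / 2).toNNReal) :=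
    memLp_id_gaussianReal' 2 (by simp)
  have h2 : ∫ x : ℝ, x ^ 2 ∂gaussianReal 0 (v / 2).toNNReal = v / 2 := by
    have := variance_fun_id_gaussianReal (μ := 0) (v := (v / 2).toNNReal)
    rw [variance_of_integral_eq_zero (by fun_prop) (by simp [integral_id_gaussianReal])] at this
    rw [this, Real.coe_toNNReal _ (by positivity)]
  rw [integral_complexGaussian]
  have h3 : ∀ x : ℝ × ℝ, ‖(x.1 + x.2 * Complex.I : ℂ)‖ ^ 2 = x.1 ^ 2 + x.2 ^ 2 := by
    intro x
    simp [← Complex.normSq_eq_norm_sq, Complex.normSq_apply]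
    ring
  simp_rw [h3]
  rw [integral_add (h.integrable_sq.comp_fst _) (h.integrable_sq.comp_snd _),
    integral_fun_fst (fun x : ℝ => x ^ 2), integral_fun_snd (fun x : ℝ => x ^ 2), h2]
  simp

theorem complexGaussian_zero : complexGaussian 0 = Measure.dirac 0 := by
  simp [complexGaussian, Measure.dirac_prod_dirac, Measure.map_dirac]
  rfl

theorem ae_ne_zero_complexGaussian {v : ℝ} (hv : 0 < v) : ∀ᵐ z ∂complexGaussian v, z ≠ 0 := by
  have hv' : (v / 2).toNNReal ≠ 0 := by simpa using hv
  have := nullSingletonClass_gaussianReal (μ := 0) hv'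
  have h0 : ∀ᵐ x ∂gaussianReal 0 (v / 2).toNNReal, x ≠ 0 := by simp [ae_iff]
  have h : ∀ᵐ x : ℝ × ℝ ∂((gaussianReal 0 (v / 2).toNNReal).prod
      (gaussianReal 0 (v / 2).toNNReal)), x.1 ≠ 0 :=
    Measure.quasiMeasurePreserving_fst.ae h0
  rw [complexGaussian, (MeasurableEquiv.measurableEmbedding _).ae_map_iff]
  filter_upwards [h] with x hx h0
  exact hx (by simpa using congrArg Complex.re h0)

open Complex in
/-- Circularly symmetric Gaussian vectors with diagonal covariance are mapped by a complex matrix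
that keeps the covariance diagonal to vectors of the same kind. -/
theorem map_pi_complexGaussian {ι κ : Type*} [Fintype ι] [Fintype κ] [DecidableEq κ]
    {v : ι → ℝ} {v' : κ → ℝ} (hv : ∀ i, 0 ≤ v i) (hv' : ∀ k, 0 ≤ v' k) (A : κ → ι → ℂ)
    (hA : ∀ k l, ∑ i, A k i * starRingEnd ℂ (A l i) * v i = if k = l then (v' k : ℂ) else 0) :
    (Measure.pi fun i => complexGaussian (v i)).map (fun g k => ∑ i, A k i * g i)
      = Measure.pi fun k => complexGaussian (v' k) := by
  have hm : Measurable fun (g : ι → ℂ) k => ∑ i, A k i * g i := by fun_prop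
  have := Measure.isProbabilityMeasure_map (μ := Measure.pi fun i => complexGaussian (v i))
    hm.aemeasurable
  rw [← charFun_eq_pi_iff]
  intro t
  have hm' : Measurable (WithLp.toLp 2 ∘ fun (g : ι → ℂ) k => ∑ i, A k i * g i :
      (ι → ℂ) → PiLp 2 fun _ : κ => ℂ) :=
    (MeasurableEquiv.toLp 2 (κ → ℂ)).measurable.comp hm
  rw [Measure.map_map (by fun_prop) hm, charFun_apply, integral_map hm'.aemeasurable
    (by fun_prop)]
  -- The matrix moves to the other side of the real inner product as its adjoint, so the
  -- characteristic function of the source law is evaluated at Aᴴt.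
  have h1 : ∀ g : ι → ℂ, inner ℝ ((WithLp.toLp 2 ∘ fun (g : ι → ℂ) k => ∑ i, A k i * g i) g) t
      = inner ℝ (WithLp.toLp 2 g)
        (WithLp.toLp 2 fun i => ∑ k, starRingEnd ℂ (A k i) * t k : PiLp 2 fun _ : ι => ℂ) := by
    intro g
    simp only [PiLp.inner_apply, Function.comp_apply, sum_inner, inner_sum]
    rw [Finset.sum_comm]
    refine Finset.sum_congr rfl fun i _ => Finset.sum_congr rfl fun k _ => ?_
    simp [Complex.inner]
    ring
  simp_rw [h1]
  have h2 := charFun_pi (μ := fun i => complexGaussian (v i))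
    (WithLp.toLp 2 fun i => ∑ k, starRingEnd ℂ (A k i) * t k : PiLp 2 fun _ : ι => ℂ)
  rw [charFun_apply, integral_map (by fun_prop) (by fun_prop)] at h2
  rw [h2]
  simp_rw [charFun_complexGaussian (hv _), charFun_complexGaussian (hv' _), ← Complex.exp_sum]
  congr 1
  rw [Finset.sum_neg_distrib, Finset.sum_neg_distrib, neg_inj]
  push_cast
  rw [← Finset.sum_div, ← Finset.sum_div]
  congr 1
  have h3 : ∀ z : ℂ, ((‖z‖ : ℝ) : ℂ) ^ 2 = starRingEnd ℂ z * z := fun z => by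
    rw [mul_comm, Complex.mul_conj']
  simp_rw [h3]
  -- The exponent is the quadratic form of A diag(v) Aᴴ at t, which `hA` makes diagonal.
  calc ∑ i, (v i : ℂ) * (starRingEnd ℂ (∑ k, starRingEnd ℂ (A k i) * t k)
        * ∑ k, starRingEnd ℂ (A k i) * t k)
      = ∑ k, ∑ l, starRingEnd ℂ (t k) * t l * ∑ i, A k i * starRingEnd ℂ (A l i) * v i := by
        simp_rw [map_sum, Finset.sum_mul_sum, Finset.mul_sum]
        rw [Finset.sum_comm]
        refine Finset.sum_congr rfl fun k _ => ?_
        rw [Finset.sum_comm]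
        refine Finset.sum_congr rfl fun l _ => Finset.sum_congr rfl fun i _ => ?_
        simp
        ring
    _ = _ := by
        refine Finset.sum_congr rfl fun k _ => ?_
        simp_rw [hA]
        simp
        ring

/-! ### Polar coordinates: modulus and argument of a Gaussian variable. -/

theorem integral_rpow_two_mul_exp_neg_div {v : ℝ} (hv : 0 < v) :
    ∫ r in Set.Ioi (0 : ℝ), r ^ 2 * Real.exp (-(r ^ 2 / v)) = v * √v * √Real.pi / 4 := by
  have h := integral_rpow_mul_exp_neg_mul_rpow (p := 2) (q := 2) (b := v⁻¹) (by norm_num)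
    (by norm_num) (by positivity)
  have h2 : Real.Gamma ((2 + 1) / 2) = √Real.pi / 2 := by
    rw [show ((2 : ℝ) + 1) / 2 = 1 / 2 + 1 by norm_num, Real.Gamma_add_one (by norm_num),
      Real.Gamma_one_half_eq]
    ring
  rw [h2, Real.inv_rpow hv.le, ← Real.rpow_neg hv.le,
    show (-(-(2 + 1) / 2) : ℝ) = 1 + 1 / 2 by norm_num, Real.rpow_add hv, ← Real.sqrt_eq_rpow,
    Real.rpow_one] at h
  rw [show v * √v * √Real.pi / 4 = v * √v * (1 / 2) * (√Real.pi / 2) by ring, ← h]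
  refine setIntegral_congr_fun measurableSet_Ioi fun r _ => ?_
  simp only [Real.rpow_two]
  rw [neg_mul, div_eq_inv_mul]

open Complex in
/-- The argument of a circularly symmetric Gaussian variable is uniform and independent of its
modulus. -/
theorem integral_norm_mul_arg_complexGaussian {v : ℝ} (hv : 0 ≤ v) (f : ℝ → ℂ) :
    ∫ z, (‖z‖ : ℂ) * f (arg z) ∂complexGaussian v
      = (√v / (4 * √Real.pi) : ℝ) * ∫ η in (-Real.pi)..Real.pi, f η := by
  rcases hv.eq_or_lt with rfl | hv
  · simp [complexGaussian_zero]
  have hv' : (v / 2).toNNReal ≠ 0 := by simpa using hv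
  have hpi := Real.pi_pos
  rw [integral_complexGaussian, gaussianReal_of_var_ne_zero _ hv',
    prod_withDensity (by fun_prop) (by fun_prop), ← Measure.volume_eq_prod,
    integral_withDensity_eq_integral_toReal_smul (by fun_prop)
      (ae_of_all _ fun x => ENNReal.mul_lt_top gaussianPDF_lt_top gaussianPDF_lt_top),
    ← integral_comp_polarCoord_symm]
  -- One factor r is the Jacobian and the other is the modulus; the two Gaussian densities multiply
  -- to e^{-r²/v}/(πv).
  have h1 : ∀ q ∈ polarCoord.target, q.1 • (gaussianPDF 0 (v / 2).toNNReal (polarCoord.symm q).1 *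
      gaussianPDF 0 (v / 2).toNNReal (polarCoord.symm q).2).toReal •
      ((‖((polarCoord.symm q).1 + (polarCoord.symm q).2 * I : ℂ)‖ : ℂ)
        * f (arg ((polarCoord.symm q).1 + (polarCoord.symm q).2 * I)))
      = ((1 / (Real.pi * v) * (q.1 ^ 2 * Real.exp (-(q.1 ^ 2 / v))) : ℝ) : ℂ) * f q.2 := by
    rintro ⟨r, η⟩ hq
    have hr : 0 < r := hq.1
    have hη : η ∈ Set.Ioo (-Real.pi) Real.pi := hq.2
    have hz : ((r * Real.cos η : ℝ) + (r * Real.sin η : ℝ) * I : ℂ)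
        = r * (Complex.cos η + Complex.sin η * I) := by push_cast; ring
    have hn : ‖(Complex.cos η + Complex.sin η * I)‖ = 1 := by
      rw [← Complex.exp_mul_I, Complex.norm_exp_ofReal_mul_I]
    simp only [polarCoord_symm_apply]
    rw [hz, Complex.arg_mul_cos_add_sin_mul_I hr ⟨hη.1, hη.2.le⟩, norm_mul, hn,
      ENNReal.toReal_mul, toReal_gaussianPDF, toReal_gaussianPDF, gaussianPDFReal_def]
    simp only [sub_zero, Real.coe_toNNReal _ (show 0 ≤ v / 2 by positivity), real_smul,
      Complex.norm_real, Real.norm_eq_abs, abs_of_pos hr, mul_one]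
    have hd : (√(2 * Real.pi * (v / 2)))⁻¹ * Real.exp (-(r * Real.cos η) ^ 2 / (2 * (v / 2)))
        * ((√(2 * Real.pi * (v / 2)))⁻¹ * Real.exp (-(r * Real.sin η) ^ 2 / (2 * (v / 2))))
        = 1 / (Real.pi * v) * Real.exp (-(r ^ 2 / v)) := by
      rw [mul_mul_mul_comm, ← Real.exp_add, ← mul_inv, Real.mul_self_sqrt (by positivity)]
      congr 2
      · rw [one_div]; congr 1; ring
      · field_simp
        linear_combination -Real.sin_sq_add_cos_sq η
    rw [hd]
    push_cast
    ring
  rw [setIntegral_congr_fun polarCoord.open_target.measurableSet h1, polarCoord_target,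
    Measure.volume_eq_prod,
    setIntegral_prod_mul (fun r : ℝ => ((1 / (Real.pi * v)
      * (r ^ 2 * Real.exp (-(r ^ 2 / v))) : ℝ) : ℂ)) f,
    intervalIntegral.integral_of_le (by linarith), integral_Ioc_eq_integral_Ioo]
  congr 1
  rw [integral_complex_ofReal, integral_const_mul, integral_rpow_two_mul_exp_neg_div hv]
  congr 1
  have : Real.pi = √Real.pi * √Real.pi := (Real.mul_self_sqrt hpi.le).symm
  field_simp
  linear_combination -this

/-! ### The phase quantizer and its circular mean. -/

open Complex in
theorem norm_exp_sub_exp_sq (x y : ℝ) :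
    ‖cexp (I * x) - cexp (I * y)‖ ^ 2 = 2 - 2 * Real.cos (x - y) := by
  rw [← Complex.normSq_eq_norm_sq, Complex.normSq_apply, mul_comm I, mul_comm I]
  simp only [sub_re, exp_ofReal_mul_I_re, sub_im, exp_ofReal_mul_I_im, Real.cos_sub]
  linear_combination Real.sin_sq_add_cos_sq x + Real.sin_sq_add_cos_sq y

theorem exp_int_level_eq {K : ℝ} (hK : K ≠ 0) (θ : ℝ) {m k q : ℤ} (h : (m : ℝ) = k + K * q) :
    Complex.exp (Complex.I * ((θ + 2 * Real.pi * m / K : ℝ) : ℂ))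
      = Complex.exp (Complex.I * ((θ + 2 * Real.pi * k / K : ℝ) : ℂ)) := by
  rw [Complex.exp_eq_exp_iff_exists_int]
  refine ⟨q, ?_⟩
  have hK' : (K : ℂ) ≠ 0 := by exact_mod_cast hK
  rw [h]
  push_cast
  field_simp
  ring

open Complex in
/-- Off the ties, the quantizer returns the level whose sector contains the point. -/
theorem IsPhaseQuantizer.exp_eq {b : ℕ} {θ₀ : ℝ} {Q : ℂ → ℝ} (hQ : IsPhaseQuantizer b θ₀ Q)
    (m : ℤ) (ξ : ℝ) (h : |ξ - (θ₀ + 2 * Real.pi * m / 2 ^ b)| < Real.pi / 2 ^ b) :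
    cexp (I * (Q (cexp (I * ξ)) : ℂ)) = cexp (I * ((θ₀ + 2 * Real.pi * m / 2 ^ b : ℝ) : ℂ)) := by
  have hpi := Real.pi_pos
  set K : ℕ := 2 ^ b with hKdef
  have hK : 0 < K := by positivity
  have hKR : (0 : ℝ) < K := by exact_mod_cast hK
  have hcast : (2 : ℝ) ^ b = K := by simp [hKdef]
  rw [hcast] at h ⊢
  obtain ⟨k', hk'⟩ := hQ.mem_levels (cexp (I * ξ))
  have hlev : ∀ k : Fin K, phaseLevel b θ₀ k = θ₀ + 2 * Real.pi * ((k : ℕ) : ℤ) / K := fun k => by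
    simp [phaseLevel, hcast]
  have hm0 : 0 ≤ m % K := Int.emod_nonneg _ (by omega)
  have hmlt : m % K < K := Int.emod_lt_of_pos _ (by omega)
  -- The sector index is an arbitrary integer; its residue modulo K is the admissible level giving
  -- the same point of the circle.
  let m' : Fin K := ⟨(m % K).toNat, by omega⟩
  have hm' : (m : ℝ) = (((m' : ℕ) : ℤ) : ℝ) + K * ((m / K : ℤ) : ℝ) := by
    have h1 : ((m' : ℕ) : ℤ) = m % K := Int.toNat_of_nonneg hm0
    rw [h1]
    exact_mod_cast (Int.emod_add_mul_ediv m K).symm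
  have hnear := hQ.nearest (cexp (I * ξ)) m'
  rw [← hk', hlev, hlev, ← exp_int_level_eq hKR.ne' θ₀ hm'] at hnear
  rw [← hk', hlev]
  have hsq := pow_le_pow_left₀ (norm_nonneg _) hnear 2
  rw [norm_exp_sub_exp_sq, norm_exp_sub_exp_sq] at hsq
  set δ := ξ - (θ₀ + 2 * Real.pi * m / K) with hδ
  set d : ℤ := m - ((k' : ℕ) : ℤ) with hd
  have hd0 : 0 ≤ d % K := Int.emod_nonneg _ (by omega)
  have hdlt : d % K < K := Int.emod_lt_of_pos _ (by omega)
  have hdR : (m : ℝ) - (((k' : ℕ) : ℤ) : ℝ) = ((d % K : ℤ) : ℝ) + K * ((d / K : ℤ) : ℝ) := by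
    have := (Int.emod_add_mul_ediv d K).symm
    rw [hd] at this
    exact_mod_cast this
  -- Residue zero means the chosen level is the same point. Otherwise it lies e ∈ [1, K−1] steps
  -- away, and cos δ − cos(δ + 2πe/K) = 2 sin(δ + πe/K) sin(πe/K) > 0 because |δ| < π/K, against its
  -- being nearest.
  rcases hd0.eq_or_lt with h0 | hpos
  · rw [← h0] at hdR
    refine (exp_int_level_eq hKR.ne' θ₀ (q := d / K) ?_).symm
    push_cast at hdR ⊢
    linarith
  · exfalso
    have hcos : Real.cos (ξ - (θ₀ + 2 * Real.pi * (((k' : ℕ) : ℤ) : ℝ) / K))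
        = Real.cos (δ + 2 * Real.pi * ((d % K : ℤ) : ℝ) / K) := by
      rw [← Real.cos_add_int_mul_two_pi (δ + 2 * Real.pi * ((d % K : ℤ) : ℝ) / K) (d / K)]
      congr 1
      rw [hδ]
      field_simp
      linear_combination 2 * Real.pi * hdR
    rw [hcos] at hsq
    obtain ⟨hl, hr⟩ := abs_lt.mp h
    have hd1 : (1 : ℝ) ≤ ((d % K : ℤ) : ℝ) := by exact_mod_cast hpos
    have hd2 : ((d % K : ℤ) : ℝ) + 1 ≤ K := by exact_mod_cast hdlt
    set e : ℝ := ((d % K : ℤ) : ℝ)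
    have he : Real.pi * e / K = Real.pi / K * e := by ring
    have hKpi : Real.pi / K * K = Real.pi := by field_simp
    have hpk : 0 < Real.pi / K := by positivity
    have hs1 : 0 < Real.sin (Real.pi * e / K) :=
      Real.sin_pos_of_pos_of_lt_pi (by positivity) (by rw [he]; nlinarith)
    have hs2 : 0 < Real.sin (δ + Real.pi * e / K) :=
      Real.sin_pos_of_pos_of_lt_pi (by rw [he]; nlinarith) (by rw [he]; nlinarith)
    have hprod := mul_pos hs1 hs2
    have hid := Real.cos_sub_cos δ (δ + 2 * Real.pi * e / K)
    rw [show (δ + (δ + 2 * Real.pi * e / K)) / 2 = δ + Real.pi * e / K by ring,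
      show (δ - (δ + 2 * Real.pi * e / K)) / 2 = -(Real.pi * e / K) by ring, Real.sin_neg] at hid
    nlinarith

-- Arbitrary tie-breaking could spoil measurability of `Q` itself. On the circle, however, the ties
-- are countably many angles, and off them the chosen point is the one obtained by rounding the
-- angle.
open Complex in
theorem IsPhaseQuantizer.measurable_exp {b : ℕ} {θ₀ : ℝ} {Q : ℂ → ℝ}
    (hQ : IsPhaseQuantizer b θ₀ Q) :
    Measurable fun ξ : ℝ => cexp (-(I * (Q (cexp (I * ξ)) : ℂ))) := by
  have hpi := Real.pi_pos
  let g : ℝ → ℝ := fun ξ => (ξ - θ₀) * 2 ^ b / (2 * Real.pi)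
  have hg : Measurable fun ξ : ℝ => cexp (-(I *
      ((θ₀ + 2 * Real.pi * (⌊g ξ + 1 / 2⌋ : ℝ) / 2 ^ b : ℝ) : ℂ))) := by
    have h1 : Measurable fun ξ : ℝ => ((⌊g ξ + 1 / 2⌋ : ℤ) : ℝ) :=
      (measurable_from_top (f := fun n : ℤ => (n : ℝ))).comp
        (Int.measurable_floor.comp (by fun_prop))
    fun_prop
  refine hg.measurable_of_countable_ne (Set.Countable.mono ?_
    (Set.countable_range fun m : ℤ => (m - 1 / 2) * (2 * Real.pi) / 2 ^ b + θ₀))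
  intro ξ hξ
  by_contra hc
  apply hξ
  simp only [Complex.exp_neg, inv_inj]
  refine (hQ.exp_eq _ ξ ?_).symm
  set m := ⌊g ξ + 1 / 2⌋ with hm
  have h1 : (m : ℝ) ≤ g ξ + 1 / 2 := Int.floor_le _
  have h2 : g ξ + 1 / 2 < m + 1 := Int.lt_floor_add_one _
  have h3 : (m : ℝ) ≠ g ξ + 1 / 2 := by
    intro h
    apply hc
    refine ⟨m, ?_⟩
    simp only [h, g]
    field_simp
    ring
  have h4 : ξ - (θ₀ + 2 * Real.pi * m / 2 ^ b) = 2 * Real.pi / 2 ^ b * (g ξ - m) := by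
    simp only [g]
    field_simp
    ring
  have h5 : |g ξ - m| < 1 / 2 := by
    rw [abs_lt]
    constructor
    · have := lt_of_le_of_ne h1 h3
      linarith
    · linarith
  rw [h4, abs_mul, abs_of_pos (by positivity),
    show Real.pi / 2 ^ b = 2 * Real.pi / 2 ^ b * (1 / 2) by ring]
  gcongr

open Complex in
theorem integral_exp_I_sub {a c : ℝ} :
    ∫ η in (c - a)..(c + a), cexp (I * (η - c)) = (2 * Real.sin a : ℝ) := by
  have h := integral_exp_mul_complex (a := -a) (b := a) (c := I) I_ne_zero
  have h2 := intervalIntegral.integral_comp_sub_right (fun η : ℝ => cexp (I * η)) c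
    (a := c - a) (b := c + a)
  push_cast at h2
  rw [h2, show c - a - c = -a by ring, show c + a - c = a by ring, h, ofReal_mul, ofReal_sin,
    Complex.sin]
  push_cast
  rw [mul_comm I, mul_comm I]
  field_simp
  rw [I_sq]
  ring_nf

-- On each of the K sectors the integrand is e^{j(η − centre)}, which integrates to 2 sin(π/K) over
-- half-width π/K.
open Complex in
theorem IsPhaseQuantizer.integral_exp {b : ℕ} {θ₀ : ℝ} {Q : ℂ → ℝ}
    (hQ : IsPhaseQuantizer b θ₀ Q) :
    ∫ η in (-Real.pi)..Real.pi, cexp (I * η) * cexp (-(I * (Q (cexp (I * η)) : ℂ)))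
      = (2 * Real.pi * nsinc (1 / (2 ^ b : ℕ)) : ℝ) := by
  have hpi := Real.pi_pos
  set F : ℝ → ℂ := fun η => cexp (I * η) * cexp (-(I * (Q (cexp (I * η)) : ℂ))) with hF
  have hper : Function.Periodic F (2 * Real.pi) := by
    intro η
    have : cexp (I * ((η + 2 * Real.pi : ℝ) : ℂ)) = cexp (I * η) := by
      rw [show I * ((η + 2 * Real.pi : ℝ) : ℂ) = I * η + 2 * Real.pi * I by push_cast; ring,
        Complex.exp_add, Complex.exp_two_pi_mul_I, mul_one]
    simp only [hF, this]
  have hmeas : Measurable F := by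
    have := hQ.measurable_exp
    fun_prop
  have hint : ∀ x y, IntervalIntegrable F volume x y := fun x y => by
    refine IntervalIntegrable.mono_fun' (g := fun _ => (1 : ℝ)) (by simp)
      hmeas.aestronglyMeasurable (ae_of_all _ fun η => ?_)
    simp only [hF, norm_mul]
    rw [mul_comm I, Complex.norm_exp_ofReal_mul_I, ← mul_neg, ← ofReal_neg, mul_comm I,
      Complex.norm_exp_ofReal_mul_I, mul_one]
  set K : ℝ := 2 ^ b with hK
  have hKpos : 0 < K := by positivity
  -- Left ends of the sectors; periodicity later moves the integration window from −π to `a 0`, so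
  -- that it is cut exactly at sector boundaries.
  set a : ℕ → ℝ := fun k => θ₀ + 2 * Real.pi * k / K - Real.pi / K with ha
  have hpiece : ∀ k : ℕ, ∫ η in (a k)..(a (k + 1)), F η = (2 * Real.sin (Real.pi / K) : ℝ) := by
    intro k
    have h1 : a (k + 1) = θ₀ + 2 * Real.pi * k / K + Real.pi / K := by
      simp only [ha]
      push_cast
      ring
    rw [h1, ← integral_exp_I_sub (c := θ₀ + 2 * Real.pi * k / K),
      intervalIntegral.integral_of_le (by simp only [ha]; have : 0 < Real.pi / K := by positivity
                                          linarith),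
      intervalIntegral.integral_of_le (by have : 0 < Real.pi / K := by positivity
                                          linarith),
      integral_Ioc_eq_integral_Ioo, integral_Ioc_eq_integral_Ioo]
    refine setIntegral_congr_fun measurableSet_Ioo fun η hη => ?_
    have h2 := hQ.exp_eq k η (by
      rw [abs_lt]
      simp only [ha, Set.mem_Ioo] at hη
      push_cast
      constructor <;> linarith)
    simp only [hF]
    rw [← hK] at h2
    rw [Complex.exp_neg, h2, ← Complex.exp_neg, ← Complex.exp_add]
    congr 1
    push_cast
    ring
  have hsum := intervalIntegral.sum_integral_adjacent_intervals (a := a) (n := 2 ^ b)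
    (fun k _ => hint _ _)
  simp_rw [hpiece] at hsum
  have ha2 : a (2 ^ b) = a 0 + 2 * Real.pi := by
    simp only [ha]
    push_cast
    rw [← hK]
    field_simp
    ring
  have hshift := hper.intervalIntegral_add_eq (-Real.pi) (a 0)
  rw [show -Real.pi + 2 * Real.pi = Real.pi by ring] at hshift
  rw [hshift, ← ha2, ← hsum, nsinc, Real.sinc_of_ne_zero (by positivity)]
  simp only [Finset.sum_const, Finset.card_range, nsmul_eq_mul]
  have hKc : (K : ℂ) ≠ 0 := by exact_mod_cast hKpos.ne'
  push_cast
  rw [show ((2 : ℂ) ^ b) = (K : ℂ) by simp [hK]]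
  have : (Real.pi : ℂ) ≠ 0 := by exact_mod_cast hpi.ne'
  rw [mul_one_div]
  field_simp

open Complex in
/-- Correlation of a circularly symmetric Gaussian variable with its quantized phase. -/
theorem IsPhaseQuantizer.integral_complexGaussian {b : ℕ} {θ₀ : ℝ} {Q : ℂ → ℝ}
    (hQ : IsPhaseQuantizer b θ₀ Q) {v : ℝ} (hv : 0 ≤ v) :
    ∫ z, z * cexp (-(I * (Q (cexp (I * arg z)) : ℂ))) ∂complexGaussian v
      = (√(Real.pi * v) / 2 * nsinc (1 / (2 ^ b : ℕ)) : ℝ) := by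
  have h := integral_norm_mul_arg_complexGaussian hv
    fun η => cexp (I * η) * cexp (-(I * (Q (cexp (I * η)) : ℂ)))
  rw [hQ.integral_exp] at h
  rw [← Complex.ofReal_mul] at h
  have hpi := Real.pi_pos
  convert h using 2
  · ext z
    rw [← mul_assoc, mul_comm I (arg z : ℂ), norm_mul_exp_arg_mul_I]
  · rw [Real.sqrt_mul hpi.le]
    have : Real.pi = √Real.pi * √Real.pi := (Real.mul_self_sqrt hpi.le).symm
    field_simp
    linear_combination -4 * √v * nsinc (1 / (2 ^ b : ℕ)) * this

theorem integral_norm_complexGaussian {v : ℝ} (hv : 0 ≤ v) :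
    ∫ z, (‖z‖ : ℂ) ∂complexGaussian v = (√(Real.pi * v) / 2 : ℝ) := by
  have h := integral_norm_mul_arg_complexGaussian hv fun _ => 1
  have hpi := Real.pi_pos
  simp only [mul_one, intervalIntegral.integral_const, Complex.real_smul] at h
  rw [h, ← Complex.ofReal_mul, Real.sqrt_mul hpi.le]
  congr 1
  have : Real.pi = √Real.pi * √Real.pi := (Real.mul_self_sqrt hpi.le).symm
  field_simp
  linear_combination 4 * √v * this

/-! ### Mean squares of sums of independent terms, and invariance under rotations. -/

-- Expand the square: cross terms factor by pairwise independence, and since the means are real,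
-- conjugation does not affect them.
open scoped ComplexConjugate in
theorem integral_norm_sum_sq {Ω ι : Type*} [Fintype ι] [MeasurableSpace Ω]
    {μ : Measure Ω} [IsProbabilityMeasure μ] {X : ι → Ω → ℂ} (hX : ∀ k, MemLp (X k) 2 μ)
    (hind : Pairwise fun k l => IndepFun (X k) (X l) μ) {V m : ι → ℝ}
    (hV : ∀ k, ∫ ω, ‖X k ω‖ ^ 2 ∂μ = V k) (hm : ∀ k, ∫ ω, X k ω ∂μ = m k) :
    Integrable (fun ω => ‖∑ k, X k ω‖ ^ 2) μ ∧
      ∫ ω, ‖∑ k, X k ω‖ ^ 2 ∂μ = ∑ k, V k + ((∑ k, m k) ^ 2 - ∑ k, m k ^ 2) := by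
  classical
  have hsum : MemLp (fun ω => ∑ k, X k ω) 2 μ := memLp_finsetSum _ fun k _ => hX k
  refine ⟨hsum.integrable_norm_pow two_ne_zero, ?_⟩
  have hint : ∀ k l, Integrable (fun ω => X k ω * conj (X l ω)) μ := fun k l =>
    (hX k).integrable_mul (hX l).star
  have hpair : ∀ k l, ∫ ω, X k ω * conj (X l ω) ∂μ
      = ((m k * m l + if k = l then V k - m k ^ 2 else 0 : ℝ) : ℂ) := by
    intro k l
    split_ifs with h
    · subst h
      simp_rw [Complex.mul_conj']
      have := integral_complex_ofReal (μ := μ) (f := fun ω => ‖X k ω‖ ^ 2)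
      push_cast at this
      rw [this, hV]
      push_cast
      ring
    · have hi := (hind h).comp (φ := id) (ψ := conj) measurable_id
        Complex.continuous_conj.measurable
      have := hi.integral_fun_mul_eq_mul_integral (hX k).aestronglyMeasurable
        (hX l).star.aestronglyMeasurable
      simp only [Function.comp_apply, id] at this
      rw [this, integral_conj, hm, hm]
      simp
  have hmain : ((∫ ω, ‖∑ k, X k ω‖ ^ 2 ∂μ : ℝ) : ℂ)
      = ((∑ k, V k + ((∑ k, m k) ^ 2 - ∑ k, m k ^ 2) : ℝ) : ℂ) := by
    rw [← integral_complex_ofReal]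
    have h1 : ∀ ω, ((‖∑ k, X k ω‖ ^ 2 : ℝ) : ℂ) = ∑ k, ∑ l, X k ω * conj (X l ω) := by
      intro ω
      rw [Complex.ofReal_pow, ← Complex.mul_conj', map_sum, Finset.sum_mul_sum]
    simp_rw [h1]
    rw [integral_finsetSum _ fun k _ => integrable_finsetSum _ fun l _ => hint k l]
    simp_rw [integral_finsetSum _ fun l _ => hint _ l, hpair]
    norm_cast
    simp_rw [Finset.sum_add_distrib]
    simp only [Finset.sum_ite_eq, Finset.mem_univ, if_true, ← Finset.mul_sum, ← Finset.sum_mul,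
      Finset.sum_sub_distrib]
    ring
  exact_mod_cast hmain

theorem map_mul_pi_complexGaussian {ι : Type*} [Fintype ι] {v : ι → ℝ}
    (hv : ∀ i, 0 ≤ v i) {c : ℂ} (hc : ‖c‖ = 1) :
    (Measure.pi fun i => complexGaussian (v i)).map (fun g i => c * g i)
      = Measure.pi fun i => complexGaussian (v i) := by
  classical
  convert map_pi_complexGaussian hv hv (fun k i => if k = i then c else 0) ?_ using 3 with g k
  · simp
  · intro k l
    have : c * starRingEnd ℂ c = 1 := by rw [Complex.mul_conj', hc]; norm_num
    by_cases h : k = l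
    · simp [h, this]
    · have h' : l ≠ k := Ne.symm h
      simp [h, h']

/-- Rotating some coordinates of a circularly symmetric Gaussian vector by a phase that depends on
the other coordinates preserves its law. -/
theorem measurePreserving_rotate_complexGaussian {ι : Type*} [Fintype ι] {v : ι → ℝ}
    (hv : ∀ i, 0 ≤ v i) (q : ι → Prop) [DecidablePred q] {r : ({i // q i} → ℂ) → ℂ}
    (hr : Measurable r) (hn : ∀ g, ‖r g‖ = 1) :
    MeasurePreserving (fun g i => if q i then g i else r (fun j => g j) * g i)
      (Measure.pi fun i => complexGaussian (v i)) (Measure.pi fun i => complexGaussian (v i)) := by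
  have he := measurePreserving_piEquivPiSubtypeProd (fun i => complexGaussian (v i)) q
  -- Skew product: the coordinates in `q` form the base, and over each base point the fibre map
  -- multiplies by a fixed unit scalar, which preserves the fibre law.
  have hs := (MeasurePreserving.id (Measure.pi fun i : Subtype q =>
    complexGaussian (v i))).skew_product (g := fun a (c : {i // ¬ q i} → ℂ) i => r a * c i)
    (μc := Measure.pi fun i : {i // ¬ q i} => complexGaussian (v i))
    (by unfold Function.uncurry; fun_prop)
    (ae_of_all _ fun a => map_mul_pi_complexGaussian
      (v := fun i : {i // ¬ q i} => v i) (fun i => hv i) (hn a))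
  convert he.symm.comp (hs.comp he) using 1
  ext g i
  by_cases h : q i <;>
  simp [h, MeasurableEquiv.piEquivPiSubtypeProd, Equiv.piEquivPiSubtypeProd]

theorem iIndepFun_eval_complexGaussian {ι : Type*} [Fintype ι] (v : ι → ℝ) :
    iIndepFun (fun i (g : ι → ℂ) => g i) (Measure.pi fun i => complexGaussian (v i)) :=
  iIndepFun_pi (X := fun _ => id) fun _ => aemeasurable_id

theorem memLp_eval_complexGaussian {ι : Type*} [Fintype ι] (v : ι → ℝ) (i : ι) :
    MemLp (fun g : ι → ℂ => g i) 2 (Measure.pi fun i => complexGaussian (v i)) :=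
  (memLp_id_complexGaussian (v i)).comp_measurePreserving
    (measurePreserving_eval (fun i => complexGaussian (v i)) i)

/-- Mean square of a sum of independent Gaussian channels, each observed up to an independent error
and phase-shifted as a function of its own observation. -/
theorem integral_norm_sq_sum_phase_mul {ι : Type*} [Fintype ι] {a d : ι → ℝ} (ha : ∀ k, 0 ≤ a k)
    (hd : ∀ k, 0 ≤ d k) (s : ι → ℝ) {f : ι → ℂ → ℂ} (hf : ∀ k, Measurable (f k))
    (hfn : ∀ k z, ‖f k z‖ = 1) {m : ι → ℝ}
    (hm : ∀ k, ∫ z, s k * z * f k z ∂complexGaussian (d k) = m k) :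
    Integrable (fun g : ι ⊕ ι → ℂ =>
        ‖∑ k, (g (Sum.inl k) + s k * g (Sum.inr k)) * f k (g (Sum.inr k))‖ ^ 2)
        (Measure.pi fun i => complexGaussian (Sum.elim a d i)) ∧
      ∫ g : ι ⊕ ι → ℂ, ‖∑ k, (g (Sum.inl k) + s k * g (Sum.inr k)) * f k (g (Sum.inr k))‖ ^ 2
        ∂(Measure.pi fun i => complexGaussian (Sum.elim a d i))
        = ∑ k, (a k + s k ^ 2 * d k) + ((∑ k, m k) ^ 2 - ∑ k, m k ^ 2) := by
  set P := Measure.pi fun i => complexGaussian (Sum.elim a d i)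
  have hI := iIndepFun_eval_complexGaussian (Sum.elim a d)
  have hL := memLp_eval_complexGaussian (Sum.elim a d)
  have heval : ∀ i {E : Type} [NormedAddCommGroup E] [NormedSpace ℝ E] (F : ℂ → E),
      AEStronglyMeasurable F (complexGaussian (Sum.elim a d i)) →
      ∫ g : ι ⊕ ι → ℂ, F (g i) ∂P = ∫ z, F z ∂complexGaussian (Sum.elim a d i) :=
    fun i E _ _ F hF => integral_comp_eval (μ := fun i => complexGaussian (Sum.elim a d i)) hF
  have hLs : ∀ k, MemLp (fun g : ι ⊕ ι → ℂ => (s k : ℂ) * g (Sum.inr k)) 2 P := fun k =>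
    (hL (Sum.inr k)).const_mul _
  have hLsum : ∀ k, MemLp (fun g : ι ⊕ ι → ℂ => g (Sum.inl k) + s k * g (Sum.inr k)) 2 P :=
    fun k => (hL (Sum.inl k)).add (hLs k)
  have hsq : ∀ k, ∫ g : ι ⊕ ι → ℂ, ‖g (Sum.inl k) + s k * g (Sum.inr k)‖ ^ 2 ∂P
      = a k + s k ^ 2 * d k := by
    intro k
    have hi : IndepFun (fun g : ι ⊕ ι → ℂ => g (Sum.inl k))
        (fun g : ι ⊕ ι → ℂ => (s k : ℂ) * g (Sum.inr k)) P :=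
      (hI.indepFun (i := Sum.inl k) (j := Sum.inr k) (by simp)).comp (φ := id)
        (ψ := fun z : ℂ => (s k : ℂ) * z) measurable_id (by fun_prop)
    -- The variances of the error and of the scaled observation add: this is the two-term, zero-mean
    -- case of the general formula.
    have h := (integral_norm_sum_sq (μ := P) (ι := Bool)
      (X := fun c g => if c then g (Sum.inl k) else s k * g (Sum.inr k))
      (V := fun c => if c then a k else s k ^ 2 * d k) (m := fun _ => 0)
      (by rintro (_ | _); exacts [hLs k, hL _]) ?_ ?_ ?_).2
    · simpa using h
    · rintro (_ | _) (_ | _) hne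
      · exact absurd rfl hne
      · simpa using hi.symm
      · simpa using hi
      · exact absurd rfl hne
    · rintro (_ | _)
      · simp only [Bool.false_eq_true, if_false, norm_mul, mul_pow]
        rw [integral_const_mul, heval (Sum.inr k) (fun z => ‖z‖ ^ 2) (by fun_prop), Sum.elim_inr,
          integral_norm_sq_complexGaussian (hd k)]
        simp
      · simp only [if_true]
        rw [heval (Sum.inl k) (fun z => ‖z‖ ^ 2) (by fun_prop), Sum.elim_inl,
          integral_norm_sq_complexGaussian (ha k)]
    · rintro (_ | _)
      · simp only [Bool.false_eq_true, if_false]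
        rw [integral_const_mul, heval (Sum.inr k) (fun z => z) (by fun_prop),
          integral_id_complexGaussian]
        simp
      · simp only [if_true]
        rw [heval (Sum.inl k) (fun z => z) (by fun_prop), integral_id_complexGaussian]
        simp
  refine integral_norm_sum_sq (fun k => (hLsum k).of_le ?_ ?_) ?_ ?_ ?_
  · have := hf k
    exact (by fun_prop : Measurable _).aestronglyMeasurable
  · exact ae_of_all _ fun g => by rw [norm_mul, hfn, mul_one]
  · intro k l hkl
    have := hf k
    have := hf l
    exact (hI.indepFun_prodMk_prodMk (fun i => measurable_pi_apply i) (Sum.inl k) (Sum.inr k)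
      (Sum.inl l) (Sum.inr l) (by simpa) (by simp) (by simp) (by simpa)).comp
      (φ := fun z : ℂ × ℂ => (z.1 + s k * z.2) * f k z.2)
      (ψ := fun z : ℂ × ℂ => (z.1 + s l * z.2) * f l z.2) (by fun_prop) (by fun_prop)
  · intro k
    simp_rw [norm_mul, hfn, mul_one]
    exact hsq k
  · intro k
    have hfk := hf k
    have hi : IndepFun (fun g : ι ⊕ ι → ℂ => g (Sum.inl k))
        (fun g : ι ⊕ ι → ℂ => f k (g (Sum.inr k))) P :=
      (hI.indepFun (i := Sum.inl k) (j := Sum.inr k) (by simp)).comp (φ := id)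
        (ψ := f k) measurable_id hfk
    have hb : ∀ X : (ι ⊕ ι → ℂ) → ℂ, MemLp X 2 P →
        Integrable (fun g => X g * f k (g (Sum.inr k))) P := fun X hX =>
      (hX.integrable one_le_two).mul_bdd (c := 1)
        (by fun_prop : Measurable fun g : ι ⊕ ι → ℂ => f k (g (Sum.inr k))).aestronglyMeasurable
        (ae_of_all _ fun g => (hfn k _).le)
    simp_rw [add_mul]
    -- The error is centred and independent of the observation that sets the phase, so only the
    -- observed part contributes to the mean.
    rw [integral_add (hb _ (hL _)) (hb _ (hLs k)),
      hi.integral_fun_mul_eq_mul_integral (hL _).aestronglyMeasurable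
        (by exact (by fun_prop : Measurable _).aestronglyMeasurable),
      heval (Sum.inl k) (fun z => z) (by fun_prop), integral_id_complexGaussian, zero_mul,
      zero_add, heval (Sum.inr k) (fun z => s k * z * f k z)
        (by exact (by fun_prop : Measurable _).aestronglyMeasurable), Sum.elim_inr, hm]

/-! ### Joint law of the channel vector and the despread noise. -/

/-- The variances of the entries of the channel vector. -/
noncomputable def channelVariance (N L : ℕ) (ρ α β : ℝ) : Fin (N + 1) → ℝ :=
  Fin.cons ρ fun _ => α * β * L

/-- The noise after correlation with the pilot matrix. -/
noncomputable def pilotNoise {Ω : Type*} {N : ℕ} (ψ : Fin (N + 1) → Fin N → ℝ)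
    (w : Fin (N + 1) → Ω → ℂ) (ω : Ω) : Fin (N + 1) → ℂ :=
  ((N : ℂ) + 1)⁻¹ • (pilotMatrix ψ).conjTranspose.mulVec fun t => w t ω

theorem channelVariance_nonneg {N L : ℕ} {ρ α β : ℝ} (hρ : 0 ≤ ρ) (hα : 0 ≤ α) (hβ : 0 ≤ β)
    (k : Fin (N + 1)) : 0 ≤ channelVariance N L ρ α β k := by
  refine Fin.cases ?_ (fun n => ?_) k
  · simpa [channelVariance] using hρ
  · simp only [channelVariance, Fin.cons_succ]
    positivity

-- All primitive variables form one independent Gaussian vector, and channel and despread noise are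
-- linear images of disjoint blocks of it. Different subarrays use different elements, and pilot
-- orthogonality keeps the noise white with variance σ²/(N+1).
open scoped ComplexConjugate in
theorem map_channel_pilotNoise {Ω : Type*} [MeasurableSpace Ω] {μ : Measure Ω}
    [IsProbabilityMeasure μ] {N L : ℕ} {ρ α β σ : ℝ} (hρ : 0 ≤ ρ) (hα : 0 ≤ α) (hβ : 0 ≤ β)
    {p : Ω → ℂ} {b : Fin N → Fin L → Ω → ℂ} {w : Fin (N + 1) → Ω → ℂ}
    (hmodel : IsRayleighModel μ ρ β σ p b w) (φ : Fin N → Fin L → ℝ)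
    {ψ : Fin (N + 1) → Fin N → ℝ}
    (hψ : (pilotMatrix ψ).conjTranspose * pilotMatrix ψ = ((N : ℂ) + 1) • 1) :
    μ.map (fun ω => Sum.elim (channelVector p (subarrayChannel α φ b) ω) (pilotNoise ψ w ω))
      = Measure.pi fun i => complexGaussian
        (Sum.elim (channelVariance N L ρ α β) (fun _ => σ ^ 2 / (N + 1)) i) := by
  set f : Unit ⊕ (Fin N × Fin L) ⊕ Fin (N + 1) → Ω → ℂ := Sum.elim (fun _ : Unit => p)
      (Sum.elim (fun q : Fin N × Fin L => b q.1 q.2) w) with hf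
  set v : Unit ⊕ (Fin N × Fin L) ⊕ Fin (N + 1) → ℝ :=
    Sum.elim (fun _ => ρ) (Sum.elim (fun _ => β) fun _ => σ ^ 2) with hv
  have hfm : ∀ i, Measurable (f i) := by
    rintro (_ | _ | _)
    exacts [hmodel.measurable_direct, hmodel.measurable_element _ _, hmodel.measurable_noise _]
  have hlaw : μ.map (fun ω i => f i ω) = Measure.pi fun i => complexGaussian (v i) := by
    rw [hmodel.indep.map_fun_eq_pi_map fun i => (hfm i).aemeasurable]
    congr 1
    funext i
    rcases i with (_ | _ | _)
    exacts [hmodel.law_direct, hmodel.law_element _ _, hmodel.law_noise _]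
  let A : Fin (N + 1) ⊕ Fin (N + 1) → Unit ⊕ (Fin N × Fin L) ⊕ Fin (N + 1) → ℂ :=
    Sum.elim
      (Fin.cons (Sum.elim (fun _ => 1) fun _ => 0) fun n => Sum.elim (fun _ => 0)
        (Sum.elim (fun q => if n = q.1 then (√α : ℂ) * Complex.exp (-(Complex.I * (φ q.1 q.2 : ℂ)))
          else 0) fun _ => 0))
      fun k => Sum.elim (fun _ => 0) (Sum.elim (fun _ => 0)
        fun t => ((N : ℂ) + 1)⁻¹ * conj (pilotMatrix ψ t k))
  have hvnn : ∀ i, 0 ≤ v i := by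
    rintro (_ | _ | _)
    exacts [hρ, hβ, sq_nonneg _]
  have hv'nn : ∀ k : Fin (N + 1) ⊕ Fin (N + 1),
      0 ≤ Sum.elim (channelVariance N L ρ α β) (fun _ => σ ^ 2 / (N + 1)) k := by
    rintro (k | _)
    · exact channelVariance_nonneg hρ hα hβ k
    · simp only [Sum.elim_inr]; positivity
  -- The deterministic phases cancel in the covariance, so each element adds αβ to the variance of
  -- its subarray.
  have hphase : ∀ x : ℝ, (√α : ℂ) * Complex.exp (-(Complex.I * x)) *
      conj ((√α : ℂ) * Complex.exp (-(Complex.I * x))) = α := by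
    intro x
    rw [Complex.mul_conj', norm_mul, ← mul_neg, ← Complex.ofReal_neg, mul_comm Complex.I,
      Complex.norm_exp_ofReal_mul_I, Complex.norm_real, Real.norm_eq_abs, mul_one, ← Complex.ofReal_pow,
      sq_abs, Real.sq_sqrt hα]
  have hgram : ∀ k l, ∑ t, conj (pilotMatrix ψ t k) * pilotMatrix ψ t l
      = if k = l then (N : ℂ) + 1 else 0 := by
    intro k l
    have := congrFun (congrFun hψ k) l
    simpa [Matrix.mul_apply, Matrix.one_apply] using this
  have hN : (N : ℂ) + 1 ≠ 0 := by exact_mod_cast N.succ_ne_zero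
  have key := map_pi_complexGaussian hvnn hv'nn A (by
    rintro (k | k) (l | l)
    · refine Fin.cases ?_ (fun n => ?_) k <;> refine Fin.cases ?_ (fun n' => ?_) l
      · simp [A, hv, channelVariance]
      · simp [A, hv, (Fin.succ_ne_zero n').symm]
      · simp [A, hv, Fin.succ_ne_zero n]
      · simp only [Sum.elim_inl, Fin.cons_succ, Fintype.sum_sum_type, Sum.elim_inr, A, hv,
          zero_mul, Finset.sum_const_zero, map_zero, mul_zero, zero_add, add_zero,
          Fintype.sum_prod_type, channelVariance, Sum.inl.injEq, Fin.succ_inj]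
        rw [Finset.sum_eq_single n]
        · by_cases h : n = n'
          · subst h
            simp only [if_true, hphase]
            simp
            ring
          · simp [h, Ne.symm h]
        · intro m _ hm
          simp [Ne.symm hm]
        · simp
    · refine Fin.cases ?_ (fun n => ?_) k <;> simp [A]
    · refine Fin.cases ?_ (fun n => ?_) l <;> simp [A]
    · simp only [Fintype.sum_sum_type, Sum.elim_inl, Sum.elim_inr, A, hv, zero_mul,
        Finset.sum_const_zero, zero_add, map_mul, map_inv₀, Complex.conj_conj, map_add, map_one,
        Complex.conj_natCast, Sum.inr.injEq]
      rw [show ∑ t, ((N : ℂ) + 1)⁻¹ * conj (pilotMatrix ψ t k)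
          * (((N : ℂ) + 1)⁻¹ * pilotMatrix ψ t l) * ((σ ^ 2 : ℝ) : ℂ)
          = ((N : ℂ) + 1)⁻¹ * ((N : ℂ) + 1)⁻¹ * ((σ ^ 2 : ℝ) : ℂ)
            * ∑ t, conj (pilotMatrix ψ t k) * pilotMatrix ψ t l by
        rw [Finset.mul_sum]
        exact Finset.sum_congr rfl fun t _ => by ring, hgram]
      split_ifs
      · push_cast
        field_simp
      · simp)
  rw [← hlaw, Measure.map_map (by fun_prop) (measurable_pi_lambda _ hfm)] at key
  rw [← key]
  congr 1
  ext ω i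
  rcases i with k | k
  · refine Fin.cases ?_ (fun n => ?_) k
    · simp [channelVector, A]
    · simp only [Sum.elim_inl, channelVector, Fin.cons_succ, subarrayChannel, Function.comp_apply,
        Fintype.sum_sum_type, Sum.elim_inr, A, zero_mul, Finset.sum_const_zero, zero_add,
        add_zero, Fintype.sum_prod_type]
      rw [Finset.sum_eq_single n]
      · simp
      · intro m _ hm
        simp [Ne.symm hm]
      · simp
  · simp [pilotNoise, A, Matrix.mulVec, dotProduct, Finset.mul_sum, mul_assoc]

/-! ### MMSE estimation from the despread observations. -/

/-- The coefficient of the linear minimum mean square error estimator. -/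
noncomputable def mmseGain (P τ V : ℝ) : ℝ := √P * V / (P * V + τ)

-- The gain solves √P V − s(P V + τ) = 0, so error and observation are uncorrelated, hence
-- independent as jointly circular Gaussians.
open scoped ComplexConjugate in
theorem map_error_observation {ι : Type*} [Fintype ι] {V : ι → ℝ} (hV : ∀ k, 0 ≤ V k) {P τ : ℝ}
    (hP : 0 ≤ P) (hτ : 0 < τ) :
    (Measure.pi fun i => complexGaussian (Sum.elim V (fun _ => τ) i)).map
      (fun g : ι ⊕ ι → ℂ => Sum.elim
        (fun k => g (Sum.inl k) - mmseGain P τ (V k) * (√P * g (Sum.inl k) + g (Sum.inr k)))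
        (fun k => √P * g (Sum.inl k) + g (Sum.inr k)))
      = Measure.pi fun i => complexGaussian
        (Sum.elim (fun k => V k * τ / (P * V k + τ)) (fun k => P * V k + τ) i) := by
  classical
  have hd : ∀ k, 0 < P * V k + τ := fun k => by have := hV k; positivity
  let A : ι ⊕ ι → ι ⊕ ι → ℂ := Sum.elim
    (fun k => Sum.elim (fun i => if k = i then ((1 - mmseGain P τ (V k) * √P : ℝ) : ℂ) else 0)
      (fun i => if k = i then ((-mmseGain P τ (V k) : ℝ) : ℂ) else 0))
    (fun k => Sum.elim (fun i => if k = i then (√P : ℂ) else 0) (fun i => if k = i then 1 else 0))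
  have key := map_pi_complexGaussian (v := Sum.elim V (fun _ => τ))
    (v' := Sum.elim (fun k => V k * τ / (P * V k + τ)) (fun k => P * V k + τ))
    (by rintro (k | k); exacts [hV k, hτ.le])
    (by
      rintro (k | k)
      · have := hV k
        have := hd k
        simp only [Sum.elim_inl]
        positivity
      · exact (hd k).le) A (by
    have hsq : √P * √P = P := Real.mul_self_sqrt hP
    rintro (k | k) (l | l)
    all_goals
      simp only [Fintype.sum_sum_type, Sum.elim_inl, Sum.elim_inr, A, ite_mul, zero_mul,
        Finset.sum_ite_eq, Finset.mem_univ, if_true, Sum.inl.injEq, Sum.inr.injEq, reduceCtorEq,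
        if_false]
      by_cases h : k = l
    · subst h
      simp only [if_true, Complex.conj_ofReal]
      norm_cast
      -- Eliminating τ in favour of the denominator D, with P written as √P·√P, leaves a rational
      -- identity in √P, V and D.
      obtain ⟨D, hD⟩ : ∃ D, D = P * V k + τ := ⟨_, rfl⟩
      have hD0 : D ≠ 0 := hD ▸ (hd k).ne'
      have hτD : τ = D - √P * √P * V k := by rw [hsq, hD]; ring
      rw [mmseGain, ← hD, hτD]
      field_simp
      ring
    · simp [h, Ne.symm h]
    · subst h
      simp only [if_true, Complex.conj_ofReal, map_one]
      norm_cast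
      obtain ⟨D, hD⟩ : ∃ D, D = P * V k + τ := ⟨_, rfl⟩
      have hD0 : D ≠ 0 := hD ▸ (hd k).ne'
      have hτD : τ = D - √P * √P * V k := by rw [hsq, hD]; ring
      rw [mmseGain, ← hD, hτD]
      field_simp
      ring
    · simp [Ne.symm h]
    · subst h
      simp only [if_true, Complex.conj_ofReal]
      norm_cast
      obtain ⟨D, hD⟩ : ∃ D, D = P * V k + τ := ⟨_, rfl⟩
      have hD0 : D ≠ 0 := hD ▸ (hd k).ne'
      have hτD : τ = D - √P * √P * V k := by rw [hsq, hD]; ring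
      rw [mmseGain, ← hD, hτD]
      field_simp
      ring
    · simp [Ne.symm h]
    · subst h
      simp only [if_true, Complex.conj_ofReal, map_one]
      norm_cast
      rw [hsq]
      ring
    · simp [h, Ne.symm h])
  rw [← key]
  congr 1
  ext g i
  rcases i with k | k
  · simp [A]
    ring
  · simp [A]

/-- If the observation carries the same information as the independent variables `X (inr k)`, then
the conditional mean of `X (inl k) + s k X (inr k)` is its second term. -/
theorem condExp_error_add_observation {Ω ι : Type*} [Fintype ι] [MeasurableSpace Ω]
    {μ : Measure Ω} [IsProbabilityMeasure μ] {X : Ω → ι ⊕ ι → ℂ} (hX : Measurable X)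
    {v : ι ⊕ ι → ℝ} (hlaw : μ.map X = Measure.pi fun i => complexGaussian (v i))
    {γ : Type*} [MeasurableSpace γ] {y : Ω → γ} {F : (ι → ℂ) → γ} (hF : Measurable F)
    (hy : ∀ ω, y ω = F fun k => X ω (Sum.inr k)) {G : γ → ι → ℂ} (hG : Measurable G)
    (hu : ∀ ω k, X ω (Sum.inr k) = G (y ω) k) (s : ι → ℂ) (k : ι) :
    condExp (MeasurableSpace.comap y inferInstance) μ
        (fun ω => X ω (Sum.inl k) + s k * X ω (Sum.inr k))
      =ᵐ[μ] fun ω => s k * X ω (Sum.inr k) := by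
  classical
  have hmp : MeasurePreserving X μ (Measure.pi fun i => complexGaussian (v i)) := ⟨hX, hlaw⟩
  have hev : ∀ i, MeasurePreserving (fun ω => X ω i) μ (complexGaussian (v i)) := fun i =>
    (measurePreserving_eval (fun i => complexGaussian (v i)) i).comp hmp
  have hL : ∀ i, Integrable (fun ω => X ω i) μ := fun i =>
    ((memLp_id_complexGaussian (v i)).comp_measurePreserving (hev i)).integrable one_le_two
  have hind : iIndepFun (fun i ω => X ω i) μ := by
    rw [iIndepFun_iff_map_fun_eq_pi_map fun i => (hev i).measurable.aemeasurable]
    simp_rw [fun i => (hev i).map_eq]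
    exact hlaw
  have hym : Measurable y := by
    have : y = fun ω => F fun k => X ω (Sum.inr k) := funext hy
    rw [this]
    fun_prop
  -- Through `F`, y is a function of the `inr` block, which is independent of the single coordinate
  -- `inl k`.
  have hek : IndepFun (fun ω => X ω (Sum.inl k)) y μ := by
    have h := hind.indepFun_finset {Sum.inl k} (Finset.univ.map ⟨Sum.inr, Sum.inr_injective⟩)
      (by simp) fun i => (hev i).measurable
    have hφ : Measurable fun g : ({Sum.inl k} : Finset (ι ⊕ ι)) → ℂ => g ⟨Sum.inl k, by simp⟩ :=
      measurable_pi_apply _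
    have hψ : Measurable fun g :
        (Finset.univ.map ⟨Sum.inr, Sum.inr_injective⟩ : Finset (ι ⊕ ι)) → ℂ =>
          F fun j => g ⟨Sum.inr j, by simp⟩ :=
      hF.comp (measurable_pi_lambda _ fun j => measurable_pi_apply _)
    have h2 := h.comp hφ hψ
    have : y = fun ω => F fun k => X ω (Sum.inr k) := funext hy
    rw [this]
    exact h2
  have h1 := condExp_indep_eq (μ := μ) (hev (Sum.inl k)).measurable.comap_le hym.comap_le
    (comap_measurable (fun ω => X ω (Sum.inl k))).stronglyMeasurable hek
  have h0 : ∫ ω, X ω (Sum.inl k) ∂μ = 0 := by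
    rw [← integral_id_complexGaussian (v (Sum.inl k)), ← (hev (Sum.inl k)).map_eq,
      integral_map (hev _).measurable.aemeasurable (by fun_prop)]
  have h2 : condExp (MeasurableSpace.comap y inferInstance) μ (fun ω => s k * X ω (Sum.inr k))
      = fun ω => s k * X ω (Sum.inr k) := by
    refine condExp_of_stronglyMeasurable hym.comap_le ?_ ((hL _).const_mul _)
    have : (fun ω => s k * X ω (Sum.inr k)) = (fun c => s k * G c k) ∘ y := by
      ext ω
      simp [hu]
    rw [this]
    exact ((by fun_prop : Measurable fun c => s k * G c k).comp
      (comap_measurable y)).stronglyMeasurable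
  have h3 := condExp_add (hL (Sum.inl k)) ((hL (Sum.inr k)).const_mul (s k))
    (MeasurableSpace.comap y inferInstance)
  filter_upwards [h1, h3] with ω hω1 hω3
  refine hω3.trans ?_
  rw [Pi.add_apply, hω1, h2, h0, zero_add]

/-! ### Average SNR with quantized and with ideal phase-shifts. -/

-- Lets a common rotation be absorbed into the argument of an estimate. It needs z ≠ 0, since the
-- convention arg 0 = 0 is not equivariant under rotation.
open Complex in
theorem exp_arg_mul_of_norm_eq_one {z r : ℂ} (hz : z ≠ 0) (hr : ‖r‖ = 1) :
    cexp (I * arg z) * r = cexp (I * arg (r * z)) := by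
  have h1 := norm_mul_exp_arg_mul_I z
  have h2 := norm_mul_exp_arg_mul_I (r * z)
  have hz' : (‖z‖ : ℂ) ≠ 0 := by exact_mod_cast norm_ne_zero_iff.mpr hz
  rw [norm_mul, hr, one_mul] at h2
  rw [mul_comm I, mul_comm I]
  apply mul_left_cancel₀ hz'
  rw [h2, ← mul_assoc, h1, mul_comm]

open Complex in
theorem norm_exp_neg_I_mul (x : ℝ) : ‖cexp (-(I * x))‖ = 1 := by
  rw [← mul_neg, ← ofReal_neg, mul_comm, norm_exp_ofReal_mul_I]

-- Gives the mean of the direct term: after the common rotation it is compensated exactly by the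
-- phase of its own estimate, so no sinc factor appears.
open Complex in
theorem integral_gain_mul_conj_phase {s d : ℝ} (hs : 0 ≤ s) (hd : 0 ≤ d) :
    ∫ z, s * z * cexp (-(I * arg (s * z))) ∂complexGaussian d = (s * (√(Real.pi * d) / 2) : ℝ) := by
  rcases hs.eq_or_lt with rfl | hs
  · simp
  · simp_rw [arg_real_mul _ hs, mul_assoc]
    rw [integral_const_mul, ofReal_mul, ← integral_norm_complexGaussian hd]
    congr 2
    ext z
    nth_rw 1 [← norm_mul_exp_arg_mul_I z]
    rw [mul_assoc, mul_comm I, ← Complex.exp_add]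
    simp

open Complex in
theorem IsPhaseQuantizer.integral_gain_mul {b : ℕ} {θ₀ : ℝ} {Q : ℂ → ℝ}
    (hQ : IsPhaseQuantizer b θ₀ Q) {s d : ℝ} (hs : 0 ≤ s) (hd : 0 ≤ d) :
    ∫ z, s * z * cexp (-(I * (Q (cexp (I * arg (s * z))) : ℂ))) ∂complexGaussian d
      = (s * (√(Real.pi * d) / 2 * nsinc (1 / (2 ^ b : ℕ))) : ℝ) := by
  rcases hs.eq_or_lt with rfl | hs
  · simp
  · simp_rw [arg_real_mul _ hs, mul_assoc]
    rw [integral_const_mul, hQ.integral_complexGaussian hd, ← ofReal_mul]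

open Complex in
/-- Mean square of the channel combined with phase-shifts quantized from the estimates. -/
theorem integral_norm_sq_quantizedPhase {Ω : Type*} [MeasurableSpace Ω] {μ : Measure Ω}
    {N : ℕ} {X : Ω → Fin (N + 1) ⊕ Fin (N + 1) → ℂ} (hX : Measurable X)
    {a d s : Fin (N + 1) → ℝ} (ha : ∀ k, 0 ≤ a k) (hd : ∀ k, 0 < d k) (hs : ∀ k, 0 ≤ s k)
    (hlaw : μ.map X = Measure.pi fun i => complexGaussian (Sum.elim a d i))
    (hdeg : ∀ n : Fin N, s n.succ = 0 → s 0 = 0 ∨ a n.succ = 0)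
    {b : ℕ} {θ₀ : ℝ} {Q : ℂ → ℝ} (hQ : IsPhaseQuantizer b θ₀ Q)
    {est : Fin (N + 1) → Ω → ℂ} (hest : ∀ k, est k =ᵐ[μ] fun ω => s k * X ω (Sum.inr k))
    {H : Ω → Fin (N + 1) → ℂ} (hH : ∀ ω k, H ω k = X ω (Sum.inl k) + s k * X ω (Sum.inr k))
    {m : Fin (N + 1) → ℝ} (hm : m = Fin.cons (s 0 * (√(Real.pi * d 0) / 2)) fun n =>
      s n.succ * (√(Real.pi * d n.succ) / 2 * nsinc (1 / (2 ^ b : ℕ)))) :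
    Integrable (fun ω => ‖H ω 0 + ∑ n : Fin N, H ω n.succ *
        cexp (-(I * (quantizedPhase Q (est n.succ ω) (est 0 ω) : ℂ)))‖ ^ 2) μ ∧
      ∫ ω, ‖H ω 0 + ∑ n : Fin N, H ω n.succ *
        cexp (-(I * (quantizedPhase Q (est n.succ ω) (est 0 ω) : ℂ)))‖ ^ 2 ∂μ
        = ∑ k, (a k + s k ^ 2 * d k) + ((∑ k, m k) ^ 2 - ∑ k, m k ^ 2) := by
  have hmp : MeasurePreserving X μ (Measure.pi fun i => complexGaussian (Sum.elim a d i)) :=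
    ⟨hX, hlaw⟩
  have hev : ∀ i, MeasurePreserving (fun ω => X ω i) μ (complexGaussian (Sum.elim a d i)) :=
    fun i => (measurePreserving_eval (fun i => complexGaussian (Sum.elim a d i)) i).comp hmp
  set f : Fin (N + 1) → ℂ → ℂ := Fin.cons (fun z => cexp (-(I * arg (s 0 * z))))
    fun n z => cexp (-(I * (Q (cexp (I * arg (s n.succ * z))) : ℂ))) with hfdef
  have hf : ∀ k, Measurable (f k) := by
    refine Fin.cases ?_ fun n => ?_
    · simp only [hfdef, Fin.cons_zero]
      fun_prop
    · simp only [hfdef, Fin.cons_succ]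
      exact hQ.measurable_exp.comp (by fun_prop : Measurable fun z : ℂ => arg (s n.succ * z))
  have hfn : ∀ k z, ‖f k z‖ = 1 := by
    refine Fin.cases (fun z => ?_) fun n z => ?_
    · exact norm_exp_neg_I_mul _
    · exact norm_exp_neg_I_mul _
  have hmean : ∀ k, ∫ z, s k * z * f k z ∂complexGaussian (d k) = m k := by
    rw [hm]
    refine Fin.cases ?_ fun n => ?_
    · exact integral_gain_mul_conj_phase (hs 0) (hd 0).le
    · exact hQ.integral_gain_mul (hs _) (hd _).le
  have hmain := integral_norm_sq_sum_phase_mul ha (fun k => (hd k).le) s hf hfn hmean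
  -- Rotate every coordinate except the direct pair by minus the phase of the direct estimate; this
  -- phase depends only on the unrotated `inr 0`.
  set R : (Fin (N + 1) ⊕ Fin (N + 1) → ℂ) → Fin (N + 1) ⊕ Fin (N + 1) → ℂ := fun g i =>
    if i = Sum.inl 0 ∨ i = Sum.inr 0 then g i
    else cexp (-(I * arg (s 0 * g (Sum.inr 0)))) * g i with hR
  have hrot : MeasurePreserving R _ _ := measurePreserving_rotate_complexGaussian (v := Sum.elim a d)
    (by rintro (k | k); exacts [ha k, (hd k).le])
    (fun i => i = Sum.inl 0 ∨ i = Sum.inr 0)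
    (r := fun g => cexp (-(I * arg (s 0 * g ⟨Sum.inr 0, Or.inr rfl⟩)))) (by fun_prop)
    (fun g => norm_exp_neg_I_mul _)
  have hcomp := hrot.comp hmp
  have hae : (fun ω => ‖H ω 0 + ∑ n : Fin N, H ω n.succ *
        cexp (-(I * (quantizedPhase Q (est n.succ ω) (est 0 ω) : ℂ)))‖ ^ 2)
      =ᵐ[μ] (fun g : Fin (N + 1) ⊕ Fin (N + 1) → ℂ =>
        ‖∑ k, (g (Sum.inl k) + s k * g (Sum.inr k)) * f k (g (Sum.inr k))‖ ^ 2) ∘ (R ∘ X) := by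
    have hne : ∀ᵐ ω ∂μ, ∀ k, X ω (Sum.inr k) ≠ 0 := ae_all_iff.mpr fun k =>
      (hev (Sum.inr k)).quasiMeasurePreserving.ae (ae_ne_zero_complexGaussian (hd k))
    have hzero : ∀ᵐ ω ∂μ, ∀ k, a k = 0 → X ω (Sum.inl k) = 0 := ae_all_iff.mpr fun k => by
      by_cases h : a k = 0
      · have : ∀ᵐ z ∂complexGaussian (Sum.elim a d (Sum.inl k)), z = 0 := by
          simp [h, complexGaussian_zero, ae_dirac_eq]
        filter_upwards [(hev (Sum.inl k)).quasiMeasurePreserving.ae this] with ω hω _ using hω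
      · exact ae_of_all _ fun ω h' => absurd h' h
    filter_upwards [hne, hzero, ae_all_iff.mpr hest] with ω h1 h2 h3
    simp only [Function.comp_apply, hR]
    set r : ℂ := cexp (-(I * arg (s 0 * X ω (Sum.inr 0)))) with hr
    have hrn : ‖r‖ = 1 := norm_exp_neg_I_mul _
    -- Insert the unit factor |r| in front, turning the SNR expression at ω into the decoupled one
    -- at the rotated point.
    rw [← one_mul ‖H ω 0 + _‖, ← hrn, ← norm_mul, mul_add, Fin.sum_univ_succ, Finset.mul_sum]
    congr 3
    · simp [hH, hfdef, hr, mul_comm]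
    · refine Finset.sum_congr rfl fun n _ => ?_
      simp only [Sum.inl.injEq, Sum.inr.injEq, reduceCtorEq, or_false, Fin.succ_ne_zero,
        if_false]
      rw [h3, h3, hH, quantizedPhase, ← hr]
      rw [show r * X ω (Sum.inl n.succ) + s n.succ * (r * X ω (Sum.inr n.succ))
        = r * (X ω (Sum.inl n.succ) + s n.succ * X ω (Sum.inr n.succ)) by ring, ← mul_assoc]
      simp only [hfdef, Fin.cons_succ]
      -- A zero estimate does not follow the rotation. Then either the direct estimate is zero too
      -- and r = 1, or the error variance vanishes and the whole term is almost surely zero.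
      by_cases hsn : s n.succ = 0
      · rcases hdeg n hsn with h0 | h0
        · have : r = 1 := by simp [hr, h0]
          simp [this, hsn]
        · simp [h2 _ h0, hsn]
      · have hz : (s n.succ : ℂ) * X ω (Sum.inr n.succ) ≠ 0 :=
          mul_ne_zero (by exact_mod_cast hsn) (h1 _)
        rw [exp_arg_mul_of_norm_eq_one hz hrn, mul_left_comm]
  refine ⟨(integrable_congr hae).mpr (hcomp.integrable_comp_of_integrable hmain.1), ?_⟩
  rw [integral_congr_ae hae, ← hmain.2, ← hcomp.map_eq,
    integral_map hcomp.measurable.aemeasurable]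
  · rfl
  · rw [hcomp.map_eq]
    exact hmain.1.aestronglyMeasurable

/-- Mean square of the channel combined with the ideal phase-shifts. -/
theorem integral_sum_norm_sq {Ω ι : Type*} [Fintype ι] [MeasurableSpace Ω] {μ : Measure Ω}
    [IsProbabilityMeasure μ] {H : Ω → ι → ℂ} (hH : Measurable H) {V : ι → ℝ} (hV : ∀ k, 0 ≤ V k)
    (hlaw : μ.map H = Measure.pi fun i => complexGaussian (V i)) :
    Integrable (fun ω => (∑ k, ‖H ω k‖) ^ 2) μ ∧
      ∫ ω, (∑ k, ‖H ω k‖) ^ 2 ∂μ = ∑ k, V k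
        + ((∑ k, √(Real.pi * V k) / 2) ^ 2 - ∑ k, (√(Real.pi * V k) / 2) ^ 2) := by
  have hmp : MeasurePreserving H μ (Measure.pi fun i => complexGaussian (V i)) := ⟨hH, hlaw⟩
  have hev : ∀ i, MeasurePreserving (fun ω => H ω i) μ (complexGaussian (V i)) :=
    fun i => (measurePreserving_eval (fun i => complexGaussian (V i)) i).comp hmp
  have hind : iIndepFun (fun i ω => H ω i) μ := by
    rw [iIndepFun_iff_map_fun_eq_pi_map fun i => (hev i).measurable.aemeasurable]
    simp_rw [fun i => (hev i).map_eq]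
    exact hlaw
  have h := integral_norm_sum_sq (μ := μ) (X := fun k ω => ((‖H ω k‖ : ℝ) : ℂ)) (V := V)
    (m := fun k => √(Real.pi * V k) / 2) (fun k => ?_) (fun k l hkl => ?_) (fun k => ?_)
    (fun k => ?_)
  · have h1 : ∀ ω, ‖∑ k, ((‖H ω k‖ : ℝ) : ℂ)‖ ^ 2 = (∑ k, ‖H ω k‖) ^ 2 := fun ω => by
      rw [← Complex.ofReal_sum, Complex.norm_real, Real.norm_eq_abs, sq_abs]
    simpa only [h1] using h
  · exact ((memLp_id_complexGaussian (V k)).comp_measurePreserving (hev k)).norm.ofReal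
  · exact (hind.indepFun hkl).comp (φ := fun z : ℂ => ((‖z‖ : ℝ) : ℂ))
      (ψ := fun z : ℂ => ((‖z‖ : ℝ) : ℂ)) (by fun_prop) (by fun_prop)
  · rw [← integral_norm_sq_complexGaussian (hV k), ← (hev k).map_eq,
      integral_map (hev k).measurable.aemeasurable (by fun_prop)]
    simp
  · rw [← integral_norm_complexGaussian (hV k), ← (hev k).map_eq,
      integral_map (hev k).measurable.aemeasurable (by fun_prop)]

/-! ### Closed forms and the limit. -/

theorem mmse_error_add_estimate {P τ V : ℝ} (hP : 0 ≤ P) (hd : P * V + τ ≠ 0) :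
    V * τ / (P * V + τ) + mmseGain P τ V ^ 2 * (P * V + τ) = V := by
  have hq : √P ^ 2 = P := Real.sq_sqrt hP
  obtain ⟨D, hD⟩ : ∃ D, D = P * V + τ := ⟨_, rfl⟩
  rw [mmseGain, div_pow, mul_pow, hq]
  rw [← hD] at hd ⊢
  rw [show τ = D - P * V by rw [hD]; ring]
  field_simp
  ring

/-- With one direct mean m_0 and N equal means m_1, the bracket (∑ m)² − ∑ m² is 2N m_0 m_1 + N(N−1)
m_1²; these are the two sinc terms, since s√d = √P V/√d. -/
theorem averageSNR_eq {M N L K : ℕ} (hN : 0 < N) (hM : (M : ℝ) = N * L) {ρ α β σ Pdata P : ℝ}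
    (hρ : 0 ≤ ρ) (hα : 0 ≤ α) (hβ : 0 ≤ β) (hσ : 0 < σ) (hP : 0 ≤ P) {m : Fin (N + 1) → ℝ}
    (hm : m = Fin.cons
      (mmseGain P (σ ^ 2 / (N + 1)) ρ * (√(Real.pi * (P * ρ + σ ^ 2 / (N + 1))) / 2))
      fun _ => mmseGain P (σ ^ 2 / (N + 1)) (α * β * L) *
        (√(Real.pi * (P * (α * β * L) + σ ^ 2 / (N + 1))) / 2 * nsinc (1 / K))) :
    averageSNR M N K ρ α β σ Pdata P = Pdata / σ ^ 2 *
      (∑ k, channelVariance N L ρ α β k + ((∑ k, m k) ^ 2 - ∑ k, m k ^ 2)) := by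
  have hNR : (0 : ℝ) < N := by exact_mod_cast hN
  have hV : 0 ≤ α * β * L := by positivity
  have hAM : α * β * M = N * (α * β * L) := by rw [hM]; ring
  have hpi := Real.pi_pos
  simp only [Fin.sum_univ_succ, hm, channelVariance, Fin.cons_zero, Fin.cons_succ,
    Finset.sum_const, Finset.card_univ, Fintype.card_fin, nsmul_eq_mul, averageSNR, hAM]
  generalize α * β * L = V at hV
  generalize nsinc (1 / K) = S
  have hd0 : 0 < P * ρ + σ ^ 2 / (N + 1) := by positivity
  have hd1 : 0 < P * V + σ ^ 2 / (N + 1) := by positivity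
  have hx0 : ρ * (P / σ ^ 2) + 1 / (N + 1) = (P * ρ + σ ^ 2 / (N + 1)) / σ ^ 2 := by
    field_simp
  have hx1 : N * V / N * (P / σ ^ 2) + 1 / (N + 1) = (P * V + σ ^ 2 / (N + 1)) / σ ^ 2 := by
    field_simp
  rw [hx0, hx1, mmseGain, mmseGain, Real.sqrt_mul hpi.le, Real.sqrt_mul hpi.le,
    Real.sqrt_mul (by positivity), Real.sqrt_div' _ (by positivity),
    Real.sqrt_div' _ (by positivity), Real.sqrt_sq hσ.le]
  generalize P * ρ + σ ^ 2 / (N + 1) = d0 at hd0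
  generalize P * V + σ ^ 2 / (N + 1) = d1 at hd1
  -- Every quantity under a root is replaced by a square, after which the identity is rational.
  obtain ⟨f0, hf0, rfl⟩ : ∃ f, 0 < f ∧ f ^ 2 = d0 := ⟨√d0, Real.sqrt_pos.mpr hd0, Real.sq_sqrt hd0.le⟩
  obtain ⟨f1, hf1, rfl⟩ : ∃ f, 0 < f ∧ f ^ 2 = d1 := ⟨√d1, Real.sqrt_pos.mpr hd1, Real.sq_sqrt hd1.le⟩
  have hq : √P ^ 2 = P := Real.sq_sqrt hP
  have he : √Real.pi ^ 2 = Real.pi := Real.sq_sqrt hpi.le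
  generalize √P = q at hq
  generalize √Real.pi = e at he
  rw [← hq, ← he, Real.sqrt_sq hf0.le, Real.sqrt_sq hf1.le]
  field_simp
  ring

theorem perfectAverageSNR_eq {M N L : ℕ} (hN : 0 < N) (hM : (M : ℝ) = N * L) {ρ α β σ Pdata : ℝ}
    (hρ : 0 ≤ ρ) (hα : 0 ≤ α) (hβ : 0 ≤ β) :
    perfectAverageSNR M N ρ α β σ Pdata = Pdata / σ ^ 2 *
      (∑ k, channelVariance N L ρ α β k
        + ((∑ k, √(Real.pi * channelVariance N L ρ α β k) / 2) ^ 2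
          - ∑ k, (√(Real.pi * channelVariance N L ρ α β k) / 2) ^ 2)) := by
  have hNR : (0 : ℝ) < N := by exact_mod_cast hN
  have hV : 0 ≤ α * β * L := by positivity
  have hAM : α * β * M = N * (α * β * L) := by rw [hM]; ring
  have hpi := Real.pi_pos
  simp only [Fin.sum_univ_succ, channelVariance, Fin.cons_zero, Fin.cons_succ,
    Finset.sum_const, Finset.card_univ, Fintype.card_fin, nsmul_eq_mul, perfectAverageSNR, hAM]
  generalize α * β * L = V at hV
  rw [show N * V * N = (N : ℝ) ^ 2 * V by ring, Real.sqrt_mul (by positivity),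
    Real.sqrt_sq hNR.le, Real.sqrt_mul hpi.le, Real.sqrt_mul hpi.le]
  have h1 : √ρ ^ 2 = ρ := Real.sq_sqrt hρ
  have h2 : √V ^ 2 = V := Real.sq_sqrt hV
  have he : √Real.pi ^ 2 = Real.pi := Real.sq_sqrt hpi.le
  generalize √ρ = r at h1
  generalize √V = t at h2
  generalize √Real.pi = e at he
  rw [← h1, ← h2, ← he]
  ring

/-- Dividing by t = P/σ² leaves the noise only as c/t → 0, while 1/K → 0 and continuity of sinc at 0
remove the quantization loss. The cases ρ = 0 and αβM = 0, where limiting denominators vanish, make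
the affected terms identically zero. -/
theorem tendsto_averageSNR {M N : ℕ} (hN : 0 < N) {ρ α β σ Pdata : ℝ}
    (hρ : 0 ≤ ρ) (hα : 0 ≤ α) (hβ : 0 ≤ β) (hσ : 0 < σ) :
    Tendsto (fun x : ℕ × ℝ => averageSNR M N x.1 ρ α β σ Pdata x.2) (atTop ×ˢ atTop)
      (𝓝 (perfectAverageSNR M N ρ α β σ Pdata)) := by
  have hNR : (0 : ℝ) < N := by exact_mod_cast hN
  set A : ℝ := α * β * M with hA
  have hA0 : 0 ≤ A := by positivity
  set c : ℝ := 1 / (N + 1) with hc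
  have hsinc : Tendsto (fun x : ℕ × ℝ => nsinc (1 / (x.1 : ℝ))) (atTop ×ˢ atTop) (𝓝 1) := by
    have h1 : Tendsto (fun x : ℝ => nsinc x) (𝓝 0) (𝓝 1) := by
      have : Continuous fun x : ℝ => nsinc x :=
        Real.continuous_sinc.comp (continuous_const.mul continuous_id)
      simpa [nsinc] using this.tendsto 0
    exact h1.comp (tendsto_one_div_atTop_nhds_zero_nat.comp tendsto_fst)
  have hx : Tendsto (fun x : ℕ × ℝ => x.2 / σ ^ 2) (atTop ×ˢ atTop) atTop :=
    (tendsto_id.atTop_div_const (by positivity)).comp tendsto_snd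
  have hlin : ∀ B : ℝ, Tendsto (fun x : ℕ × ℝ => B + c / (x.2 / σ ^ 2)) (atTop ×ˢ atTop)
      (𝓝 B) := fun B => by
    simpa using (tendsto_const_nhds (x := B)).add (hx.const_div_atTop c)
  have h2 : Tendsto (fun x : ℕ × ℝ => ρ * A * (x.2 / σ ^ 2) * nsinc (1 / x.1)
      / √((ρ * (x.2 / σ ^ 2) + c) * (A / N * (x.2 / σ ^ 2) + c))) (atTop ×ˢ atTop)
      (𝓝 (√ρ * √(A * N))) := by
    rcases hρ.eq_or_lt with rfl | hρ
    · simp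
    rcases hA0.eq_or_lt with h0 | hA1
    · simp [← h0]
    have hlim : Tendsto (fun x : ℕ × ℝ => ρ * A * nsinc (1 / x.1)
        / √((ρ + c / (x.2 / σ ^ 2)) * (A / N + c / (x.2 / σ ^ 2)))) (atTop ×ˢ atTop)
        (𝓝 (ρ * A * 1 / √(ρ * (A / N)))) :=
      (hsinc.const_mul _).div ((hlin ρ).mul (hlin (A / N))).sqrt (by positivity)
    have hval : ρ * A * 1 / √(ρ * (A / N)) = √ρ * √(A * N) := by
      rw [div_eq_iff (by positivity), ← Real.sqrt_mul hρ.le, ← Real.sqrt_mul (by positivity),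
        show ρ * (A * N) * (ρ * (A / N)) = (ρ * A) ^ 2 by field_simp,
        Real.sqrt_sq (by positivity), mul_one]
    rw [hval] at hlim
    refine hlim.congr' ?_
    filter_upwards [hx.eventually_gt_atTop 0] with x hx0
    generalize x.2 / σ ^ 2 = t at hx0
    rw [show (ρ * t + c) * (A / N * t + c) = t ^ 2 * ((ρ + c / t) * (A / N + c / t)) by
      field_simp, Real.sqrt_mul (sq_nonneg t), Real.sqrt_sq hx0.le]
    field_simp
  have h3 : Tendsto (fun x : ℕ × ℝ => A ^ 2 * (x.2 / σ ^ 2) * nsinc (1 / x.1) ^ 2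
      / (A / N * (x.2 / σ ^ 2) + c)) (atTop ×ˢ atTop) (𝓝 (A * N)) := by
    rcases hA0.eq_or_lt with h0 | hA1
    · simp [← h0]
    have hlim : Tendsto (fun x : ℕ × ℝ => A ^ 2 * nsinc (1 / x.1) ^ 2
        / (A / N + c / (x.2 / σ ^ 2))) (atTop ×ˢ atTop) (𝓝 (A ^ 2 * 1 ^ 2 / (A / N))) :=
      ((hsinc.pow 2).const_mul _).div (hlin (A / N)) (by positivity)
    have hval : A ^ 2 * 1 ^ 2 / (A / N) = A * N := by field_simp
    rw [hval] at hlim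
    refine hlim.congr' ?_
    filter_upwards [hx.eventually_gt_atTop 0] with x hx0
    generalize x.2 / σ ^ 2 = t at hx0
    rw [show A / N * t + c = t * (A / N + c / t) by field_simp]
    field_simp
  have hfinal := (((tendsto_const_nhds (x := ρ + A)).add (h2.const_mul (Real.pi / 2))).add
    (h3.const_mul (Real.pi / 4 * (1 - 1 / N)))).const_mul (Pdata / σ ^ 2)
  have hval : perfectAverageSNR M N ρ α β σ Pdata = Pdata / σ ^ 2 *
      (ρ + A + Real.pi / 2 * (√ρ * √(A * N)) + Real.pi / 4 * (1 - 1 / N) * (A * N)) := by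
    have h1 : √ρ ^ 2 = ρ := Real.sq_sqrt hρ
    have h4 : √(A * N) ^ 2 = A * N := Real.sq_sqrt (by positivity)
    rw [perfectAverageSNR, ← hA, add_sq, h1, h4]
    field_simp
    ring
  rw [hval]
  exact hfinal

/-- The ideal phase-shifts give every term the phase of p, so the moduli add; z = |z|e^{j arg z}
holds at 0 too, so no exceptional case arises. -/
theorem norm_add_sum_mul_exp_arg_sub {N : ℕ} (p : ℂ) (Z : Fin N → ℂ) :
    ‖p + ∑ n, Z n * Complex.exp (-(Complex.I * ((Complex.arg (Z n) - Complex.arg p : ℝ) : ℂ)))‖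
      = ‖p‖ + ∑ n, ‖Z n‖ := by
  have hZ : ∀ n, Z n * Complex.exp (-(Complex.I * ((Complex.arg (Z n) - Complex.arg p : ℝ) : ℂ)))
      = ‖Z n‖ * Complex.exp (Complex.arg p * Complex.I) := by
    intro n
    nth_rw 1 [← Complex.norm_mul_exp_arg_mul_I (Z n)]
    rw [mul_assoc, ← Complex.exp_add]
    push_cast
    ring_nf
  simp_rw [hZ]
  nth_rw 1 [← Complex.norm_mul_exp_arg_mul_I p]
  rw [← Finset.sum_mul, ← add_mul, norm_mul, Complex.norm_exp_ofReal_mul_I, mul_one]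
  norm_cast
  rw [Real.norm_eq_abs, abs_of_nonneg (by positivity)]

theorem map_eval_inl_complexGaussian {ι κ : Type*} [Fintype ι] [Fintype κ] {V : ι → ℝ}
    {τ : κ → ℝ} (hV : ∀ k, 0 ≤ V k) (hτ : ∀ k, 0 ≤ τ k) :
    (Measure.pi fun i => complexGaussian (Sum.elim V τ i)).map (fun g k => g (Sum.inl k))
      = Measure.pi fun k => complexGaussian (V k) := by
  classical
  convert map_pi_complexGaussian (v := Sum.elim V τ)
    (by rintro (k | k); exacts [hV k, hτ k]) hV
    (fun k => Sum.elim (fun i => if k = i then 1 else 0) fun _ => 0) ?_ using 3 with g k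
  · simp
  · intro k l
    by_cases h : k = l
    · simp [h]
    · simp [h]

theorem pilotMatrix_mul_conjTranspose {N : ℕ} {ψ : Fin (N + 1) → Fin N → ℝ}
    (hψ : (pilotMatrix ψ).conjTranspose * pilotMatrix ψ = ((N : ℂ) + 1) • 1) :
    pilotMatrix ψ * (pilotMatrix ψ).conjTranspose = ((N : ℂ) + 1) • 1 := by
  have hN : (N : ℂ) + 1 ≠ 0 := by exact_mod_cast N.succ_ne_zero
  have h : (((N : ℂ) + 1)⁻¹ • (pilotMatrix ψ).conjTranspose) * pilotMatrix ψ = 1 := by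
    rw [Matrix.smul_mul, hψ, smul_smul, inv_mul_cancel₀ hN, one_smul]
  have h2 := mul_eq_one_comm.mp h
  rw [Matrix.mul_smul] at h2
  rw [← h2, smul_smul, mul_inv_cancel₀ hN, one_smul]

theorem measurable_mulVec {m n : Type*} [Fintype m] [Fintype n] (A : Matrix m n ℂ) :
    Measurable fun v : n → ℂ => A.mulVec v :=
  (Continuous.matrix_mulVec continuous_const continuous_id).measurable

end RIS

/-! ### Assembly of the theorem. -/

theorem theorem1 {Ω : Type*} [MeasurableSpace Ω] (μ : Measure Ω) [IsProbabilityMeasure μ]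
    (M N : ℕ) (hN : 0 < N) (hNM : N ∣ M)
    (ρ α β σ Pdata Ppilot : ℝ) (hρ : 0 ≤ ρ) (hα : 0 ≤ α) (hβ : 0 ≤ β) (hσ : 0 < σ)
    (hPdata : 0 ≤ Pdata) (hPpilot : 0 ≤ Ppilot)
    -- the channels, the pilot noise, and the fixed phases of the paths from the surface
    (p : Ω → ℂ) (b : Fin N → Fin (M / N) → Ω → ℂ) (w : Fin (N + 1) → Ω → ℂ)
    (hmodel : RIS.IsRayleighModel μ ρ β σ p b w)
    (φ : Fin N → Fin (M / N) → ℝ)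
    (Z : Fin N → Ω → ℂ) (hZ : Z = RIS.subarrayChannel α φ b)
    -- the scaled unitary pilot matrix and the received pilot signal
    (ψ : Fin (N + 1) → Fin N → ℝ)
    (hψ : (RIS.pilotMatrix ψ).conjTranspose * RIS.pilotMatrix ψ = ((N : ℂ) + 1) • 1)
    (y : Ω → Fin (N + 1) → ℂ)
    (hy : y = RIS.pilotSignal Ppilot ψ (RIS.channelVector p Z) w)
    -- the quantizer
    (bits : ℕ) (θ₀ : ℝ) (Q : ℂ → ℝ) (hQ : RIS.IsPhaseQuantizer bits θ₀ Q)
    -- the data SNR with the quantized phases obtained from the estimates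
    (snr : Ω → ℝ)
    (hsnr : snr = fun ω => RIS.dataSNR Pdata σ (p ω) (fun n => Z n ω) fun n =>
      RIS.quantizedPhase Q (RIS.mmseEstimate μ (Z n) y ω) (RIS.mmseEstimate μ p y ω))
    -- the data SNR with perfect knowledge of the channels and unquantized phases
    (snrPerfect : Ω → ℝ)
    (hsnrPerfect : snrPerfect = fun ω => RIS.dataSNR Pdata σ (p ω) (fun n => Z n ω) fun n =>
      Complex.arg (Z n ω) - Complex.arg (p ω)) :
    (Integrable snr μ ∧
      ∫ ω, snr ω ∂μ = RIS.averageSNR M N (2 ^ bits) ρ α β σ Pdata Ppilot) ∧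
    (Integrable snrPerfect μ ∧
      ∫ ω, snrPerfect ω ∂μ = RIS.perfectAverageSNR M N ρ α β σ Pdata) ∧
    Tendsto (fun x : ℕ × ℝ => RIS.averageSNR M N x.1 ρ α β σ Pdata x.2) (atTop ×ˢ atTop)
      (𝓝 (RIS.perfectAverageSNR M N ρ α β σ Pdata)) := by
  have hM : (M : ℝ) = N * (M / N : ℕ) := by exact_mod_cast (Nat.mul_div_cancel' hNM).symm
  have hNc : (N : ℂ) + 1 ≠ 0 := by exact_mod_cast N.succ_ne_zero
  set τ : ℝ := σ ^ 2 / (N + 1) with hτdef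
  have hτ : 0 < τ := by positivity
  set V := RIS.channelVariance N (M / N) ρ α β with hVdef
  have hV : ∀ k, 0 ≤ V k := RIS.channelVariance_nonneg hρ hα hβ
  have hlaw := RIS.map_channel_pilotNoise hρ hα hβ hmodel φ hψ
  rw [← hZ] at hlaw
  set h := RIS.channelVector p Z with hh
  set w' := RIS.pilotNoise ψ w with hw'
  have hhm : Measurable h := by
    have hZm : ∀ n, Measurable (Z n) := fun n => by
      have := hmodel.measurable_element n
      rw [hZ]
      unfold RIS.subarrayChannel
      fun_prop
    refine measurable_pi_lambda _ (Fin.cases hmodel.measurable_direct fun n => hZm n)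
  have hw'm : Measurable w' :=
    ((RIS.measurable_mulVec (RIS.pilotMatrix ψ).conjTranspose).comp
      (measurable_pi_lambda (fun ω t => w t ω) hmodel.measurable_noise)).const_smul ((N : ℂ) + 1)⁻¹
  have hgm : Measurable fun ω => Sum.elim (h ω) (w' ω) := by
    refine measurable_pi_lambda _ ?_
    rintro (k | k)
    · exact (measurable_pi_apply k).comp hhm
    · exact (measurable_pi_apply k).comp hw'm
  refine ⟨?_, ?_, RIS.tendsto_averageSNR hN hρ hα hβ hσ⟩
  · set s : Fin (N + 1) → ℝ := fun k => RIS.mmseGain Ppilot τ (V k) with hs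
    set X : Ω → Fin (N + 1) ⊕ Fin (N + 1) → ℂ := fun ω => Sum.elim
      (fun k => h ω k - s k * (√Ppilot * h ω k + w' ω k))
      (fun k => √Ppilot * h ω k + w' ω k) with hX
    have hd : ∀ k, 0 < Ppilot * V k + τ := fun k => by have := hV k; positivity
    have herr := RIS.map_error_observation hV hPpilot hτ
    rw [← hlaw, Measure.map_map ?_ hgm] at herr
    swap
    · refine measurable_pi_lambda _ ?_
      rintro (k | k) <;> simp only [Sum.elim_inl, Sum.elim_inr] <;> fun_prop
    change μ.map X = _ at herr
    have hXm : Measurable X := by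
      refine measurable_pi_lambda _ ?_
      rintro (k | k) <;> simp only [hX, Sum.elim_inl, Sum.elim_inr] <;> fun_prop
    -- Despreading the pilots recovers u from y; together with the converse `hyu` this makes y and u
    -- carry the same information.
    have hu : ∀ ω, (fun k => X ω (Sum.inr k))
        = ((N : ℂ) + 1)⁻¹ • (RIS.pilotMatrix ψ).conjTranspose.mulVec (y ω) := by
      intro ω
      ext k
      rw [hy, RIS.pilotSignal, Matrix.mulVec_add, Matrix.mulVec_smul, Matrix.mulVec_mulVec, hψ,
        Matrix.smul_mulVec, Matrix.one_mulVec]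
      simp only [hX, hw', RIS.pilotNoise, Sum.elim_inr, Pi.smul_apply, Pi.add_apply, smul_eq_mul]
      field_simp
    have hyu : ∀ ω, y ω = (RIS.pilotMatrix ψ).mulVec fun k => X ω (Sum.inr k) := by
      intro ω
      rw [hu, Matrix.mulVec_smul, Matrix.mulVec_mulVec, RIS.pilotMatrix_mul_conjTranspose hψ,
        Matrix.smul_mulVec, Matrix.one_mulVec, smul_smul, inv_mul_cancel₀ hNc, one_smul]
    have hH : ∀ ω k, h ω k = X ω (Sum.inl k) + s k * X ω (Sum.inr k) := fun ω k => by
      simp [hX]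
    have hest : ∀ k, RIS.mmseEstimate μ (fun ω => h ω k) y
        =ᵐ[μ] fun ω => s k * X ω (Sum.inr k) := by
      intro k
      have := RIS.condExp_error_add_observation hXm herr (RIS.measurable_mulVec _) hyu
        (G := fun c => ((N : ℂ) + 1)⁻¹ • (RIS.pilotMatrix ψ).conjTranspose.mulVec c)
        ((RIS.measurable_mulVec (RIS.pilotMatrix ψ).conjTranspose).const_smul ((N : ℂ) + 1)⁻¹)
        (fun ω k => congrFun (hu ω) k)
        (fun k => (s k : ℂ)) k
      simpa only [← hH, RIS.mmseEstimate] using this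
    -- A gain vanishes only if P = 0, when all gains vanish, or if V = 0, when the error variance
    -- vanishes.
    have hdeg : ∀ n : Fin N, s n.succ = 0 →
        s 0 = 0 ∨ V n.succ * τ / (Ppilot * V n.succ + τ) = 0 := by
      intro n hn
      simp only [hs, RIS.mmseGain, div_eq_zero_iff, mul_eq_zero, (hd _).ne', or_false] at hn ⊢
      rcases hn with hn | hn
      · exact Or.inl (Or.inl hn)
      · exact Or.inr (Or.inl hn)
    have hmain := RIS.integral_norm_sq_quantizedPhase hXm
      (fun k => div_nonneg (mul_nonneg (hV k) hτ.le) (hd k).le) hd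
      (fun k => div_nonneg (mul_nonneg (Real.sqrt_nonneg _) (hV k)) (hd k).le) herr hdeg hQ hest
      hH rfl
    have hsnr' : snr = fun ω => Pdata / σ ^ 2 * ‖h ω 0 + ∑ n : Fin N, h ω n.succ *
        Complex.exp (-(Complex.I * (RIS.quantizedPhase Q
          (RIS.mmseEstimate μ (fun ω => h ω n.succ) y ω)
          (RIS.mmseEstimate μ (fun ω => h ω 0) y ω) : ℂ)))‖ ^ 2 := hsnr
    rw [hsnr', integral_const_mul, hmain.2, RIS.averageSNR_eq hN hM hρ hα hβ hσ hPpilot rfl]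
    refine ⟨hmain.1.const_mul _, ?_⟩
    -- Error variance plus estimate variance is the channel variance, which turns the first sum into
    -- ρ + αβM.
    exact congrArg (fun x => Pdata / σ ^ 2 * (x + _)) (Finset.sum_congr rfl fun k _ =>
      RIS.mmse_error_add_estimate hPpilot (hd k).ne')
  · have hhlaw : μ.map h = Measure.pi fun k => RIS.complexGaussian (V k) := by
      rw [← RIS.map_eval_inl_complexGaussian hV (fun _ : Fin (N + 1) => hτ.le), ← hlaw,
        Measure.map_map (by fun_prop) hgm]
      rfl
    have hmain := RIS.integral_sum_norm_sq hhm hV hhlaw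
    have hsnr' : snrPerfect = fun ω => Pdata / σ ^ 2 * (∑ k, ‖h ω k‖) ^ 2 := by
      rw [hsnrPerfect]
      ext ω
      rw [RIS.dataSNR, RIS.norm_add_sum_mul_exp_arg_sub, Fin.sum_univ_succ]
      rfl
    rw [hsnr', integral_const_mul, hmain.2, RIS.perfectAverageSNR_eq hN hM hρ hα hβ]
    exact ⟨hmain.1.const_mul _, rfl⟩
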